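/- Let $k$ be a local field of characteristic zero, $|\cdot|$ its normalized absolute value (the module of Haar measure; on $\mathbb C$ it is $|z|=z\bar z$), $\psi$ a nontrivial continuous unitary additive character of $k$, and $dr$ the Haar measure on $k$ that is self-dual with respect to $\psi(rt)$. Let $(V,q)$ be a non-degenerate finite-dimensional quadratic space over $k$ with $\dim V\ge 2$, put $q(X,Y)=q(X+Y)-q(X)-q(Y)$, and let $dX$ be the Haar measure on $V$ that is self-dual with respect to $\psi(q(X,Y))$. For $W\in L^1(k)$ and $f\in L^1(V)$ define $$\mathcal F_2W(t)=\int_k W(r)\,\psi(r^2t)\,dr,\qquad \mathcal F_qf(t)=\int_V f(X)\,\psi(t\,q(X))\,dX .$$ Let $\phi$ be a Bruhat–Schwartz function on $V$ (a Schwartz function if $k$ is archimedean, a locally constant function of compact support if $k$ is nonarchimedean), and let $W\in L^1(k)$ be a complex-valued even function such that $W(x)^2|x|^{-1}\in L^1(k)$. For $\delta\in k^\times$ set $V_{[\delta]}=\{X\in V: q(X)\in\delta (k^{\times})^2\}$. Then $$\int_k \mathcal F_2W(\delta t)\,\mathcal F_q\phi(-t)\,dt \;=\; 2|2\delta|^{-1}\int_{V_{[\delta]}}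 W\!\left(\sqrt{\delta^{-1}q(X)}\right)\phi(X)\,\left|\delta^{-1}q(X)\right|^{-1/2}\,dX ,$$ where both integrals converge absolutely; the choice of the square root does not matter because $W$ is even. -/

import Mathlib

open MeasureTheory

noncomputable section

namespace QuadraticFourier

/-- The normalized absolute value `|a|` of a locally compact field: the factor by which
multiplication by `a` scales Haar measure (so `|z| = z * conj z` on `ℂ`), with `|0| = 0`. -/
def modulus {k : Type*} [NontriviallyNormedField k] [LocallyCompactSpace k] (a : k) : ℝ :=
  open Classical in
  if h : a = 0 then 0 else (distribHaarChar k (Units.mk0 a h) : ℝ)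

/-- The Fourier transform `ℱ f (x) = ∫ f(y) ψ(B(y, x)) dy` attached to an additive character `ψ`
of `k` and a bilinear form `B` on `E`. -/
def bilinFourier {k E : Type*} [Field k] [AddCommGroup E] [Module k E] [MeasurableSpace E]
    (ψ : AddChar k Circle) (B : LinearMap.BilinForm k E) (μ : Measure E) (f : E → ℂ) (x : E) : ℂ :=
  ∫ y, f y * (ψ (B y x) : ℂ) ∂μ

/-- `μ` is the self-dual Haar measure of `E` for the pairing `ψ(B(x, y))`: it is a Haar measure
and the inversion formula `ℱ (ℱ f) (x) = f (-x)` holds for continuous integrable `f` whose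
transform is integrable. -/
def IsSelfDual {k E : Type*} [Field k] [AddCommGroup E] [Module k E] [TopologicalSpace E]
    [MeasurableSpace E] (ψ : AddChar k Circle) (B : LinearMap.BilinForm k E)
    (μ : Measure E) : Prop :=
  μ.IsAddHaarMeasure ∧
    ∀ f : E → ℂ, Continuous f → Integrable f μ → Integrable (bilinFourier ψ B μ f) μ →
      ∀ x, bilinFourier ψ B μ (bilinFourier ψ B μ f) x = f (-x)

/-- `ℱ₂ W (t) = ∫ W(r) ψ(r² t) dr`. -/
def fourierTwo {k : Type*} [Field k] [MeasurableSpace k]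
    (ψ : AddChar k Circle) (μ : Measure k) (W : k → ℂ) (t : k) : ℂ :=
  ∫ r, W r * (ψ (r ^ 2 * t) : ℂ) ∂μ

/-- `ℱ_q f (t) = ∫ f(X) ψ(t q(X)) dX`. -/
def fourierQuad {k V : Type*} [Field k] [AddCommGroup V] [Module k V] [MeasurableSpace V]
    (ψ : AddChar k Circle) (q : QuadraticForm k V) (ν : Measure V) (f : V → ℂ) (t : k) : ℂ :=
  ∫ X, f X * (ψ (t * q X) : ℂ) ∂ν

/-- Bruhat–Schwartz functions on a finite-dimensional vector space `V` over the local field `k`.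
If `k` is nonarchimedean: locally constant functions with compact support.
If `k` is archimedean: Schwartz functions of the real coordinates of `V`; an additive homeomorphism
`V ≃ ℝᴺ` is automatically real linear, so the choice of `e` does not matter. -/
def IsBruhatSchwartz (k : Type*) {V : Type*} [NontriviallyNormedField k] [AddCommGroup V]
    [TopologicalSpace V] (φ : V → ℂ) : Prop :=
  (IsUltrametricDist k ∧ IsLocallyConstant φ ∧ HasCompactSupport φ) ∨
  (¬ IsUltrametricDist k ∧ ∃ (N : ℕ) (e : V ≃ₜ+ EuclideanSpace ℝ (Fin N))
    (f : SchwartzMap (EuclideanSpace ℝ (Fin N)) ℂ), ∀ X, φ X = f (e X))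

/-- The set `V_[δ]` of vectors `X` with `q(X) ∈ δ (kˣ)²`. -/
def squareClassSet {k V : Type*} [Field k] [AddCommGroup V] [Module k V]
    (q : QuadraticForm k V) (δ : k) : Set V :=
  {X | ∃ a : k, a ≠ 0 ∧ q X = δ * a ^ 2}

/-- A chosen square root of `a`, if there is one. -/
def root {k : Type*} [Field k] (a : k) : k :=
  open Classical in
  if h : ∃ r : k, r ^ 2 = a then h.choose else 0

end QuadraticFourier

end

/-!
As `W` is even, pushing `W(r) dr` forward along `r ↦ δ r²` shows that `t ↦ ℱ₂W(δt)` is the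
Fourier transform `Ĝ` of an explicit function `G` supported on the square class of `δ`; the
hypotheses on `W` say that `G ∈ L¹ ∩ L²`. The theorem thus becomes the Parseval-type identity
`∫ Ĝ(t) ℱ_qφ(-t) dt = ∫ φ(X) G(q(X)) dX`.

The autocorrelation of `φ` along `t ↦ ψ(t q(X))` and Fourier inversion bound `|ℱ_qφ(t)|` by a
multiple of `|t|^{-n/2}`, `n = dim V`, so `n ≥ 2` makes the left side an `L²`-bounded functional
of `G`. When `φ ≥ 0`, duality then shows that the image of `φ(X) dX` under `q` has a density in
`L²`; a general `φ` is dominated by such functions (by `|φ|`, or by a sum of dilates of a bump in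
the archimedean case), which bounds the right side. Both sides being `L²`-continuous in `G`, it
suffices to treat continuous compactly supported `G`, where the identity is Fourier inversion
tested against a summation kernel.
-/

namespace QuadraticFourier

open Filter Topology ENNReal Pointwise ComplexConjugate

section Modulus

variable {k : Type*} [NontriviallyNormedField k] [LocallyCompactSpace k]

lemma modulus_zero : modulus (0 : k) = 0 := by simp [modulus]

lemma modulus_of_ne_zero {a : k} (ha : a ≠ 0) :
    modulus a = (distribHaarChar k (Units.mk0 a ha) : ℝ) := by simp [modulus, ha]

lemma modulus_pos {a : k} (ha : a ≠ 0) : 0 < modulus a := by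
  rw [modulus_of_ne_zero ha]
  exact_mod_cast distribHaarChar_pos

lemma modulus_nonneg (a : k) : 0 ≤ modulus a := by
  rcases eq_or_ne a 0 with rfl | ha
  · exact modulus_zero.ge
  · exact (modulus_pos ha).le

lemma modulus_mul (a b : k) : modulus (a * b) = modulus a * modulus b := by
  rcases eq_or_ne a 0 with rfl | ha
  · simp [modulus_zero]
  rcases eq_or_ne b 0 with rfl | hb
  · simp [modulus_zero]
  rw [modulus_of_ne_zero ha, modulus_of_ne_zero hb, modulus_of_ne_zero (mul_ne_zero ha hb),
    ← NNReal.coe_mul, ← map_mul, Units.mk0_mul]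

lemma modulus_one : modulus (1 : k) = 1 := by
  rw [modulus_of_ne_zero one_ne_zero]; simp

lemma modulus_inv (a : k) : modulus a⁻¹ = (modulus a)⁻¹ := by
  rcases eq_or_ne a 0 with rfl | ha
  · simp [modulus_zero]
  exact eq_inv_of_mul_eq_one_left (by rw [← modulus_mul, inv_mul_cancel₀ ha, modulus_one])

lemma modulus_pow (a : k) (n : ℕ) : modulus (a ^ n) = modulus a ^ n := by
  induction n with
  | zero => simp [modulus_one]
  | succ n ih => rw [pow_succ, modulus_mul, ih, pow_succ]

instance (priority := 50) properSpace_of_locallyCompact : ProperSpace k :=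
  ProperSpace.of_locallyCompactSpace k

section HaarMeasure

variable [MeasurableSpace k] [BorelSpace k] (μ : Measure k) [μ.IsAddHaarMeasure]

lemma measure_smul_set {a : k} (ha : a ≠ 0) (s : Set k) :
    μ ((Units.mk0 a ha) • s) = ENNReal.ofReal (modulus a) * μ s := by
  rw [← distribHaarChar_mul μ, modulus_of_ne_zero ha, ENNReal.ofReal_coe_nnreal]

lemma map_mul_left_haar {a : k} (ha : a ≠ 0) :
    μ.map (fun x => a * x) = ENNReal.ofReal (modulus a)⁻¹ • μ := by
  ext s hs
  rw [Measure.map_apply (by fun_prop) hs, Measure.smul_apply, smul_eq_mul, ← modulus_inv,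
    ← measure_smul_set μ (inv_ne_zero ha)]
  congr 1
  ext x
  rw [Set.mem_smul_set_iff_inv_smul_mem]
  simp [Units.smul_def]

lemma lintegral_comp_mul_left {a : k} (ha : a ≠ 0) (f : k → ℝ≥0∞) :
    ∫⁻ x, f (a * x) ∂μ = ENNReal.ofReal (modulus a)⁻¹ * ∫⁻ x, f x ∂μ := by
  rw [← smul_eq_mul, ← lintegral_smul_measure, ← map_mul_left_haar μ ha]
  exact ((Homeomorph.mulLeft₀ a ha).measurableEmbedding.lintegral_map _).symm

lemma integral_comp_mul_left {a : k} (ha : a ≠ 0) (f : k → ℂ) :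
    ∫ x, f (a * x) ∂μ = ((modulus a)⁻¹ : ℝ) * ∫ x, f x ∂μ := by
  have h := (Homeomorph.mulLeft₀ a ha).measurableEmbedding.integral_map (μ := μ) f
  rw [Homeomorph.coe_mulLeft₀, map_mul_left_haar μ ha, integral_smul_measure,
    ENNReal.toReal_ofReal (inv_nonneg.2 (modulus_nonneg a))] at h
  rw [← h]; simp

lemma integrable_comp_mul_left {E : Type*} [NormedAddCommGroup E] {a : k} (ha : a ≠ 0) {f : k → E}
    (hf : Integrable f μ) : Integrable (fun x => f (a * x)) μ := by
  refine ((Homeomorph.mulLeft₀ a ha).measurableEmbedding.integrable_map_iff).1 ?_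
  rw [Homeomorph.coe_mulLeft₀, map_mul_left_haar μ ha]
  exact hf.smul_measure ENNReal.ofReal_ne_top

lemma ofReal_modulus_eq {a : k} (ha : a ≠ 0) :
    ENNReal.ofReal (modulus a) =
      μ (Metric.closedBall 0 ‖a‖) / μ (Metric.closedBall (0 : k) 1) := by
  have h0 : μ (Metric.closedBall (0 : k) 1) ≠ 0 :=
    (Metric.measure_closedBall_pos μ _ one_pos).ne'
  have h1 : μ (Metric.closedBall (0 : k) 1) ≠ ∞ := (isCompact_closedBall _ _).measure_ne_top
  rw [ENNReal.eq_div_iff h0 h1, mul_comm, ← measure_smul_set μ ha]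
  congr 1
  ext x
  rw [Set.mem_smul_set_iff_inv_smul_mem]
  simp [Units.smul_def, inv_mul_le_one₀ (norm_pos_iff.2 ha)]

end HaarMeasure

lemma modulus_le_of_norm_le {a b : k} (h : ‖a‖ ≤ ‖b‖) : modulus a ≤ modulus b := by
  borelize k
  rcases eq_or_ne a 0 with rfl | ha
  · rw [modulus_zero]; exact modulus_nonneg b
  have hb : b ≠ 0 := norm_pos_iff.1 ((norm_pos_iff.2 ha).trans_le h)
  rw [← ENNReal.ofReal_le_ofReal_iff (modulus_nonneg b), ofReal_modulus_eq Measure.addHaar ha,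
    ofReal_modulus_eq Measure.addHaar hb]
  gcongr

lemma modulus_neg (a : k) : modulus (-a) = modulus a :=
  le_antisymm (modulus_le_of_norm_le (norm_neg a).le) (modulus_le_of_norm_le (norm_neg a).ge)

lemma one_le_modulus {a : k} (h : 1 ≤ ‖a‖) : 1 ≤ modulus a := by
  rw [← modulus_one (k := k)]
  exact modulus_le_of_norm_le (by simpa using h)

lemma tendsto_measure_closedBall_nhdsGT {X : Type*} [PseudoMetricSpace X] [ProperSpace X]
    [MeasurableSpace X] [OpensMeasurableSpace X] (ρ : Measure X) [IsFiniteMeasureOnCompacts ρ]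
    (x : X) (r : ℝ) :
    Tendsto (fun s => ρ (Metric.closedBall x s)) (𝓝[>] r) (𝓝 (ρ (Metric.closedBall x r))) := by
  have h := tendsto_measure_biInter_gt (μ := ρ) (s := Metric.closedBall x) (a := r)
    (fun s _ => Metric.isClosed_closedBall.nullMeasurableSet)
    (fun i j _ hij => Metric.closedBall_subset_closedBall hij)
    ⟨r + 1, lt_add_one r, (isCompact_closedBall _ _).measure_ne_top⟩
  have hI : (⋂ s > r, Metric.closedBall x s) = Metric.closedBall x r := by
    ext y
    simp only [Set.mem_iInter, Metric.mem_closedBall]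
    exact ⟨le_of_forall_gt_imp_ge_of_dense, fun h s hs => h.trans hs.le⟩
  rwa [hI] at h

lemma eventually_modulus_lt {c : ℝ} (hc : 1 < c) : ∀ᶠ a : k in 𝓝 1, modulus a < c := by
  borelize k
  let μ : Measure k := Measure.addHaar
  have hlt : μ (Metric.closedBall (0 : k) 1) < ENNReal.ofReal c * μ (Metric.closedBall 0 1) := by
    conv_lhs => rw [← one_mul (μ _)]
    rw [ENNReal.mul_lt_mul_iff_left (Metric.measure_closedBall_pos μ _ one_pos).ne'
      (isCompact_closedBall _ _).measure_ne_top]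
    simpa using hc
  obtain ⟨r, hr, hr1⟩ := (((tendsto_measure_closedBall_nhdsGT μ 0 1).eventually_lt_const hlt).and
    self_mem_nhdsWithin).exists
  have hnorm : ∀ᶠ a : k in 𝓝 1, ‖a‖ < r :=
    (continuous_norm.tendsto (1 : k)).eventually_lt_const (by simpa using hr1)
  filter_upwards [hnorm] with a har
  rcases eq_or_ne a 0 with rfl | ha
  · rw [modulus_zero]; linarith
  rw [← ENNReal.ofReal_lt_ofReal_iff (by linarith), ofReal_modulus_eq μ ha]
  exact ENNReal.div_lt_of_lt_mul
    ((measure_mono (Metric.closedBall_subset_closedBall har.le)).trans_lt hr)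

lemma continuousAt_modulus_one : ContinuousAt (modulus : k → ℝ) 1 := by
  rw [ContinuousAt, modulus_one]
  refine tendsto_order.2 ⟨fun c hc => ?_, fun c hc => eventually_modulus_lt hc⟩
  have hne : ∀ᶠ a : k in 𝓝 1, a ≠ 0 := eventually_ne_nhds one_ne_zero
  rcases le_or_gt c 0 with hc0 | hc0
  · filter_upwards [hne] with a ha
    exact hc0.trans_lt (modulus_pos ha)
  have hinv : Tendsto (fun a : k => a⁻¹) (𝓝 1) (𝓝 1) := by
    simpa using (continuousAt_inv₀ (one_ne_zero (α := k))).tendsto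
  filter_upwards [hinv.eventually (eventually_modulus_lt ((one_lt_inv₀ hc0).2 hc)), hne]
    with a ha ha0
  rw [modulus_inv] at ha
  exact (inv_lt_inv₀ (modulus_pos ha0) hc0).1 ha

lemma continuousAt_modulus {a : k} (ha : a ≠ 0) : ContinuousAt (modulus : k → ℝ) a := by
  have h : (modulus : k → ℝ) = fun x => modulus a * modulus (a⁻¹ * x) := by
    ext x; rw [← modulus_mul, mul_inv_cancel_left₀ ha]
  rw [h]
  refine ContinuousAt.mul continuousAt_const (ContinuousAt.comp (g := modulus) ?_
    (continuous_const_mul a⁻¹).continuousAt)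
  rw [inv_mul_cancel₀ ha]
  exact continuousAt_modulus_one

lemma measurable_modulus [MeasurableSpace k] [BorelSpace k] : Measurable (modulus : k → ℝ) := by
  refine measurable_of_measurable_on_compl_singleton 0 ?_
  refine Continuous.measurable (continuous_iff_continuousAt.2 fun x => ?_)
  exact (continuousAt_modulus x.2).comp continuousAt_subtype_val

end Modulus

section Squares

variable {k : Type*}

/-- The set `(kˣ)²` of nonzero squares of a field. -/
def nonzeroSquares (k : Type*) [Field k] : Set k := {u | ∃ r : k, r ≠ 0 ∧ r ^ 2 = u}

lemma mul_mem_nonzeroSquares [Field k] {a u : k} (ha : a ≠ 0) :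
    a ^ 2 * u ∈ nonzeroSquares k ↔ u ∈ nonzeroSquares k := by
  constructor
  · rintro ⟨r, hr, h⟩
    refine ⟨r / a, div_ne_zero hr ha, ?_⟩
    rw [div_pow, h, mul_div_cancel_left₀ _ (pow_ne_zero 2 ha)]
  · rintro ⟨r, hr, rfl⟩
    exact ⟨a * r, mul_ne_zero ha hr, mul_pow _ _ _⟩

lemma inv_mem_nonzeroSquares [Field k] {u : k} :
    u⁻¹ ∈ nonzeroSquares k ↔ u ∈ nonzeroSquares k := by
  have inv_mem : ∀ v : k, v ∈ nonzeroSquares k → v⁻¹ ∈ nonzeroSquares k := by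
    rintro _ ⟨r, hr, rfl⟩
    exact ⟨r⁻¹, inv_ne_zero hr, inv_pow _ _⟩
  exact ⟨fun h => inv_inv u ▸ inv_mem _ h, inv_mem u⟩

variable [NontriviallyNormedField k] [CompleteSpace k] [NeZero (2 : k)]

lemma map_sq_nhds {a : k} (ha : a ≠ 0) : map (fun x : k => x ^ 2) (𝓝 a) = 𝓝 (a ^ 2) := by
  have h : HasStrictDerivAt (fun x : k => x ^ 2) (2 * a) a := by
    simpa using hasStrictDerivAt_pow 2 a
  exact h.map_nhds_eq (mul_ne_zero two_ne_zero ha)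

lemma isOpen_image_sq {s : Set k} (hs : IsOpen s) (h0 : 0 ∉ s) :
    IsOpen ((fun x : k => x ^ 2) '' s) := by
  rw [isOpen_iff_mem_nhds]
  rintro _ ⟨a, ha, rfl⟩
  rw [← map_sq_nhds (ne_of_mem_of_not_mem ha h0)]
  exact image_mem_map (hs.mem_nhds ha)

lemma isOpen_nonzeroSquares : IsOpen (nonzeroSquares k) := by
  have h : nonzeroSquares k = (fun x : k => x ^ 2) '' {0}ᶜ := by
    ext u; simp [nonzeroSquares]
  rw [h]
  exact isOpen_image_sq isOpen_compl_singleton (by simp)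

end Squares

section Multiplicative

/-- Uniqueness of Haar measure: both sides are `∫∫ F(r) w(r u) dσ(u) dρ(r)`. -/
theorem lintegral_mul_lintegral_eq_of_mul_left_invariant {G : Type*} [CommGroupWithZero G]
    [MeasurableSpace G] [MeasurableMul₂ G] [MeasurableInv G] {ρ σ : Measure G} [SFinite ρ]
    [SFinite σ] {S : Set G} (h0 : 0 ∉ S) (hρS : ∀ᵐ x ∂ρ, x ∈ S) (hσS : ∀ᵐ x ∂σ, x ∈ S)
    (hρ : ∀ u ∈ S, MeasurePreserving (u * ·) ρ ρ) (hσ : ∀ u ∈ S, MeasurePreserving (u * ·) σ σ)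
    {F w : G → ℝ≥0∞} (hF : Measurable F) (hw : Measurable w) :
    (∫⁻ x, F x ∂ρ) * ∫⁻ x, w x ∂σ = (∫⁻ x, w x ∂ρ) * ∫⁻ x, F x⁻¹ ∂σ := by
  calc (∫⁻ x, F x ∂ρ) * ∫⁻ x, w x ∂σ
      = ∫⁻ r, ∫⁻ u, F r * w (r * u) ∂σ ∂ρ := by
        rw [← lintegral_mul_const _ hF]
        refine lintegral_congr_ae ?_
        filter_upwards [hρS] with r hr
        rw [lintegral_const_mul _ (by fun_prop), (hσ r hr).lintegral_comp hw]
    _ = ∫⁻ u, ∫⁻ r, F r * w (r * u) ∂ρ ∂σ := lintegral_lintegral_swap (by fun_prop)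
    _ = ∫⁻ u, ∫⁻ r, F (u⁻¹ * r) * w r ∂ρ ∂σ := by
        refine lintegral_congr_ae ?_
        filter_upwards [hσS] with u hu
        have hu0 : u ≠ 0 := ne_of_mem_of_not_mem hu h0
        rw [← (hρ u hu).lintegral_comp (f := fun r => F (u⁻¹ * r) * w r) (by fun_prop)]
        simp only [inv_mul_cancel_left₀ hu0]
        simp only [mul_comm u]
    _ = ∫⁻ r, ∫⁻ u, F (u⁻¹ * r) * w r ∂σ ∂ρ := lintegral_lintegral_swap (by fun_prop)
    _ = (∫⁻ x, w x ∂ρ) * ∫⁻ x, F x⁻¹ ∂σ := by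
        rw [← lintegral_mul_const _ hw]
        refine lintegral_congr_ae ?_
        filter_upwards [hρS] with r hr
        have hr0 : r ≠ 0 := ne_of_mem_of_not_mem hr h0
        rw [lintegral_mul_const _ (by fun_prop), mul_comm,
          ← (hσ r hr).lintegral_comp (f := fun u => F (u⁻¹ * r)) (by fun_prop)]
        simp only [mul_inv, mul_comm r⁻¹, inv_mul_cancel_right₀ hr0]

variable {k : Type*} [NontriviallyNormedField k] [LocallyCompactSpace k]
  [MeasurableSpace k] [BorelSpace k] (μ : Measure k)

/-- The measure `dx / |x|` on `k`: Haar measure of the multiplicative group `kˣ`,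
extended by `0`. -/
noncomputable def mulHaar (μ : Measure k) : Measure k :=
  μ.withDensity fun x => ENNReal.ofReal (modulus x)⁻¹

lemma measurable_ofReal_inv_modulus : Measurable fun x : k => ENNReal.ofReal (modulus x)⁻¹ :=
  measurable_modulus.inv.ennreal_ofReal

lemma lintegral_mulHaar {f : k → ℝ≥0∞} (hf : Measurable f) :
    ∫⁻ x, f x ∂mulHaar μ = ∫⁻ x, ENNReal.ofReal (modulus x)⁻¹ * f x ∂μ :=
  lintegral_withDensity_eq_lintegral_mul _ measurable_ofReal_inv_modulus hf

lemma setLIntegral_mulHaar {s : Set k} (hs : MeasurableSet s) {f : k → ℝ≥0∞} (hf : Measurable f) :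
    ∫⁻ x in s, f x ∂mulHaar μ = ∫⁻ x in s, ENNReal.ofReal (modulus x)⁻¹ * f x ∂μ :=
  setLIntegral_withDensity_eq_setLIntegral_mul _ measurable_ofReal_inv_modulus hf hs

lemma ae_mulHaar_ne_zero : ∀ᵐ x ∂mulHaar μ, x ≠ 0 := by
  rw [ae_iff]
  simp only [ne_eq, not_not, Set.ofPred_eq_eq_singleton]
  rw [mulHaar, withDensity_apply _ (measurableSet_singleton 0)]
  simp [modulus_zero]

instance sFinite_mulHaar [SFinite μ] : SFinite (mulHaar μ) := by unfold mulHaar; infer_instance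

variable [μ.IsAddHaarMeasure]

lemma measurePreserving_mul_left_mulHaar {a : k} (ha : a ≠ 0) :
    MeasurePreserving (a * ·) (mulHaar μ) (mulHaar μ) := by
  refine ⟨measurable_const_mul a, Measure.ext_of_lintegral _ fun f hf => ?_⟩
  rw [lintegral_map hf (measurable_const_mul a), lintegral_mulHaar μ (by fun_prop),
    lintegral_mulHaar μ hf]
  have h : ∀ x, ENNReal.ofReal (modulus x)⁻¹ * f (a * x) =
      ENNReal.ofReal (modulus a) * (ENNReal.ofReal (modulus (a * x))⁻¹ * f (a * x)) := by
    intro x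
    rw [← mul_assoc, ← ENNReal.ofReal_mul (modulus_nonneg a), modulus_mul, mul_inv,
      mul_inv_cancel_left₀ (modulus_pos ha).ne']
  simp_rw [h]
  rw [lintegral_const_mul' _ _ ENNReal.ofReal_ne_top,
    lintegral_comp_mul_left μ ha (fun x => ENNReal.ofReal (modulus x)⁻¹ * f x), ← mul_assoc,
    ← ENNReal.ofReal_mul (modulus_nonneg a), mul_inv_cancel₀ (modulus_pos ha).ne',
    ENNReal.ofReal_one, one_mul]

lemma exists_mulHaar_pos_lt_top :
    ∃ s : Set k, MeasurableSet s ∧ mulHaar μ s ≠ 0 ∧ mulHaar μ s ≠ ∞ := by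
  have hpos : ∀ᶠ a : k in 𝓝 1, 2⁻¹ < modulus a :=
    continuousAt_modulus_one.eventually_const_lt (by rw [modulus_one]; norm_num)
  obtain ⟨ε, hε, hball⟩ := Metric.nhds_basis_closedBall.eventually_iff.1
    (hpos.and (eventually_modulus_lt one_lt_two))
  have hm : MeasurableSet (Metric.closedBall (1 : k) ε) := Metric.isClosed_closedBall.measurableSet
  refine ⟨Metric.closedBall 1 ε, hm, ne_of_gt ?_, ne_of_lt ?_⟩ <;>
    rw [mulHaar, withDensity_apply _ hm]
  · calc 0 < ENNReal.ofReal 2⁻¹ * μ (Metric.closedBall (1 : k) ε) :=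
          ENNReal.mul_pos (by simp) (Metric.measure_closedBall_pos μ _ hε).ne'
      _ = ∫⁻ _ in Metric.closedBall (1 : k) ε, ENNReal.ofReal 2⁻¹ ∂μ := by rw [setLIntegral_const]
      _ ≤ _ := setLIntegral_mono measurable_ofReal_inv_modulus fun x hx =>
          ENNReal.ofReal_le_ofReal (inv_anti₀ (by linarith [(hball hx).1]) (hball hx).2.le)
  · calc _ ≤ ∫⁻ _ in Metric.closedBall (1 : k) ε, ENNReal.ofReal 2 ∂μ :=
          setLIntegral_mono measurable_const fun x hx => ENNReal.ofReal_le_ofReal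
            (inv_le_of_inv_le₀ two_pos (hball hx).1.le)
      _ = ENNReal.ofReal 2 * μ (Metric.closedBall (1 : k) ε) := by rw [setLIntegral_const]
      _ < ∞ := ENNReal.mul_lt_top ENNReal.ofReal_lt_top (isCompact_closedBall _ _).measure_lt_top

lemma lintegral_mulHaar_comp_inv {f : k → ℝ≥0∞} (hf : Measurable f) :
    ∫⁻ x, f x⁻¹ ∂mulHaar μ = ∫⁻ x, f x ∂mulHaar μ := by
  obtain ⟨s, hs, h0, h1⟩ := exists_mulHaar_pos_lt_top μ
  have h := lintegral_mul_lintegral_eq_of_mul_left_invariant (S := {0}ᶜ) (by simp)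
    (ae_mulHaar_ne_zero μ) (ae_mulHaar_ne_zero μ)
    (fun u hu => measurePreserving_mul_left_mulHaar μ hu)
    (fun u hu => measurePreserving_mul_left_mulHaar μ hu) hf (measurable_one.indicator hs)
  rw [lintegral_indicator_one hs, mul_comm] at h
  exact ((ENNReal.mul_right_inj h0 h1).1 h).symm

variable [NeZero (2 : k)]

lemma lintegral_mulHaar_sq_mul_lintegral_nonzeroSquares {F w : k → ℝ≥0∞} (hF : Measurable F)
    (hw : Measurable w) :
    (∫⁻ x, F (x ^ 2) ∂mulHaar μ) * ∫⁻ x in nonzeroSquares k, w x ∂mulHaar μ =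
      (∫⁻ x, w (x ^ 2) ∂mulHaar μ) * ∫⁻ x in nonzeroSquares k, F x ∂mulHaar μ := by
  have hS : MeasurableSet (nonzeroSquares k) := isOpen_nonzeroSquares.measurableSet
  have hsq : Measurable fun x : k => x ^ 2 := by fun_prop
  have invariant_map_sq : ∀ u ∈ nonzeroSquares k,
      MeasurePreserving (u * ·) ((mulHaar μ).map (· ^ 2)) ((mulHaar μ).map (· ^ 2)) := by
    rintro _ ⟨a, ha, rfl⟩
    refine ⟨measurable_const_mul _, ?_⟩
    conv_rhs => rw [← (measurePreserving_mul_left_mulHaar μ ha).map_eq]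
    rw [Measure.map_map (measurable_const_mul _) hsq, Measure.map_map hsq (measurable_const_mul _)]
    congr 1 with x
    exact (mul_pow a x 2).symm
  have invariant_restrict : ∀ u ∈ nonzeroSquares k, MeasurePreserving (u * ·)
      ((mulHaar μ).restrict (nonzeroSquares k)) ((mulHaar μ).restrict (nonzeroSquares k)) := by
    rintro _ ⟨a, ha, rfl⟩
    have h := (measurePreserving_mul_left_mulHaar μ (pow_ne_zero 2 ha)).restrict_preimage hS
    rwa [show (a ^ 2 * ·) ⁻¹' nonzeroSquares k = nonzeroSquares k from
      Set.ext fun u => mul_mem_nonzeroSquares ha] at h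
  have ae_map_sq : ∀ᵐ x ∂(mulHaar μ).map (· ^ 2), x ∈ nonzeroSquares k :=
    (ae_map_iff hsq.aemeasurable hS).2 ((ae_mulHaar_ne_zero μ).mono fun x hx => ⟨x, hx, rfl⟩)
  have h := lintegral_mul_lintegral_eq_of_mul_left_invariant
    (by rintro ⟨r, hr, h⟩; exact pow_ne_zero 2 hr h) ae_map_sq (ae_restrict_mem hS)
    invariant_map_sq invariant_restrict hF hw
  rw [lintegral_map hF hsq, lintegral_map hw hsq] at h
  rw [h, ← lintegral_indicator hS, ← lintegral_indicator hS,
    ← lintegral_mulHaar_comp_inv μ (hF.indicator hS)]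
  congr 2 with x
  by_cases hx : x ∈ nonzeroSquares k <;> simp [hx, inv_mem_nonzeroSquares]

end Multiplicative

section HasDerivAt

variable {k : Type*} [NontriviallyNormedField k]

lemma eventually_smallSets_disjoint_neg [NeZero (2 : k)] :
    ∀ᶠ U in (𝓝 (1 : k)).smallSets, Disjoint U (-U) := by
  have h1 : (1 : k) ≠ -1 := fun h => two_ne_zero (α := k) (by linear_combination h)
  obtain ⟨s, hs, t, ht, hst⟩ := Filter.disjoint_iff.1 (disjoint_nhds_nhds.2 h1)
  have ht' : -t ∈ 𝓝 (1 : k) := continuous_neg.continuousAt.preimage_mem_nhds ht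
  filter_upwards [eventually_smallSets_subset.2 (inter_mem hs ht')] with U hU
  exact hst.mono (fun x hx => (hU hx).1) fun x hx => by simpa using (hU hx).2

variable {f : k → k} {a c : k}

lemma tendsto_add_mul_nhdsNE_zero (a x : k) :
    Tendsto (fun l : k => a + l * x) (𝓝[≠] 0) (𝓝 a) := by
  have h : Tendsto (fun l : k => a + l * x) (𝓝 0) (𝓝 (a + 0 * x)) :=
    Continuous.tendsto (by fun_prop) 0
  rw [zero_mul, add_zero] at h
  exact h.mono_left nhdsWithin_le_nhds

lemma tendsto_div_of_hasDerivAt (hf : HasDerivAt f c a) (x : k) :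
    Tendsto (fun l : k => (f (a + l * x) - f a) / l) (𝓝[≠] 0) (𝓝 (c * x)) := by
  have hline : HasDerivAt (fun l : k => a + l * x) x 0 := by
    simpa using ((hasDerivAt_id (0 : k)).mul_const x).const_add a
  have hcomp : HasDerivAt (fun l : k => f (a + l * x)) (c * x) 0 :=
    HasDerivAt.comp (0 : k) (h₂ := f) (by simpa using hf) hline
  refine hcomp.tendsto_slope_zero.congr fun l => ?_
  simp [div_eq_inv_mul]

lemma exists_eventually_norm_sub_le_of_hasDerivAt (hf : HasDerivAt f c a) (hc : c ≠ 0) :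
    ∃ C > 0, ∀ᶠ x in 𝓝 a, ‖x - a‖ ≤ C * ‖f x - f a‖ := by
  have h : (fun x => x - a) =O[𝓝 a] fun x => f x - f a := by
    exact (HasDerivAtFilter.isTheta_sub hf hc).isBigO_symm.comp_tendsto
      (tendsto_id.prodMk tendsto_const_pure)
  obtain ⟨C, hC, hCb⟩ := h.exists_pos
  exact ⟨C, hC, hCb.bound⟩

lemma indicator_comp_affine_le {h : k → ℝ≥0∞} {g : k → NNReal} {U : Set k} {A : ℝ≥0∞} {M : NNReal}
    {C R : ℝ} (hU : U ⊆ {x | h x ≤ A ∧ ‖x - a‖ ≤ C * ‖f x - f a‖})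
    (hR : tsupport g ⊆ Metric.closedBall 0 R) (hM : ∀ y, g y ≤ M) (hC : 0 ≤ C)
    {l : k} (hl : l ≠ 0) (x : k) :
    U.indicator (fun y => h y * g ((f y - f a) / l)) (a + l * x) ≤
      (Metric.closedBall (0 : k) (C * R)).indicator (fun _ => A * M) x := by
  by_cases hxU : a + l * x ∈ U
  swap
  · rw [Set.indicator_of_notMem hxU]
    exact zero_le
  by_cases hgx : g ((f (a + l * x) - f a) / l) = 0
  · rw [Set.indicator_of_mem hxU, hgx]
    simp
  have hfx : ‖f (a + l * x) - f a‖ ≤ R * ‖l‖ := by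
    have h := hR (subset_tsupport _ hgx)
    rwa [mem_closedBall_zero_iff, norm_div, div_le_iff₀ (norm_pos_iff.2 hl)] at h
  have hxR : x ∈ Metric.closedBall (0 : k) (C * R) := by
    have h := (hU hxU).2.trans (mul_le_mul_of_nonneg_left hfx hC)
    rw [add_sub_cancel_left, norm_mul, mul_comm, ← mul_assoc] at h
    exact mem_closedBall_zero_iff.2 (le_of_mul_le_mul_right h (norm_pos_iff.2 hl))
  rw [Set.indicator_of_mem hxU, Set.indicator_of_mem hxR]
  gcongr
  · exact (hU hxU).1
  · exact hM _

end HasDerivAt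

section SquareMap

variable {k : Type*} [NontriviallyNormedField k] [LocallyCompactSpace k]
  [MeasurableSpace k] [BorelSpace k] (μ : Measure k) [μ.IsAddHaarMeasure]

lemma lintegral_eq_modulus_mul_lintegral_comp_affine {a : k} (ha : a ≠ 0) (b : k)
    (f : k → ℝ≥0∞) :
    ∫⁻ x, f x ∂μ = ENNReal.ofReal (modulus a) * ∫⁻ x, f (b + a * x) ∂μ := by
  rw [lintegral_comp_mul_left μ ha (fun x => f (b + x)), lintegral_add_left_eq_self f b,
    ← mul_assoc, ← ENNReal.ofReal_mul (modulus_nonneg a), mul_inv_cancel₀ (modulus_pos ha).ne',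
    ENNReal.ofReal_one, one_mul]

theorem eventually_smallSets_tendsto_setLIntegral_of_hasDerivAt {f : k → k} {a c : k}
    (hf : HasDerivAt f c a) (hc : c ≠ 0) (hfm : Measurable f) {h : k → ℝ≥0∞} (hhm : Measurable h)
    (hh : ContinuousAt h a) (hha : h a ≠ ∞) {g : k → NNReal} (hg : Continuous g)
    (hgs : HasCompactSupport g) :
    ∀ᶠ U in (𝓝 a).smallSets, U ∈ 𝓝 a → MeasurableSet U →
      Tendsto (fun l => ENNReal.ofReal (modulus l)⁻¹ * ∫⁻ x in U, h x * g ((f x - f a) / l) ∂μ)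
        (𝓝[≠] 0) (𝓝 (h a * ∫⁻ x, g (c * x) ∂μ)) := by
  obtain ⟨C, hC0, hC⟩ := exists_eventually_norm_sub_le_of_hasDerivAt hf hc
  have hgood : {x | h x ≤ h a + 1 ∧ ‖x - a‖ ≤ C * ‖f x - f a‖} ∈ 𝓝 a :=
    ((hh.eventually_lt_const (ENNReal.lt_add_right hha one_ne_zero)).mono fun _ => le_of_lt).and
      hC
  filter_upwards [eventually_smallSets_subset.2 hgood] with U hUgood hU hUm
  obtain ⟨R, hR⟩ := hgs.isCompact.isBounded.subset_closedBall 0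
  obtain ⟨M, hM⟩ := (hg.bddAbove_range_of_hasCompactSupport hgs)
  let I : k → k → ℝ≥0∞ := fun l => U.indicator fun x => h x * g ((f x - f a) / l)
  have hIm : ∀ l, Measurable (I l) := fun l => (hhm.mul (by fun_prop)).indicator hUm
  have hsubst : ∀ l : k, l ≠ 0 →
      ENNReal.ofReal (modulus l)⁻¹ * ∫⁻ x in U, h x * g ((f x - f a) / l) ∂μ =
        ∫⁻ x, I l (a + l * x) ∂μ := by
    intro l hl
    rw [← lintegral_indicator hUm, lintegral_eq_modulus_mul_lintegral_comp_affine μ hl a,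
      ← mul_assoc, ← ENNReal.ofReal_mul (inv_nonneg.2 (modulus_nonneg l)),
      inv_mul_cancel₀ (modulus_pos hl).ne', ENNReal.ofReal_one, one_mul]
  rw [← lintegral_const_mul _ (by fun_prop)]
  refine Tendsto.congr' (eventually_mem_nhdsWithin.mono fun l hl => (hsubst l hl).symm) ?_
  refine tendsto_lintegral_filter_of_dominated_convergence
    ((Metric.closedBall (0 : k) (C * R)).indicator fun _ => (h a + 1) * M)
    (Eventually.of_forall fun l => (hIm l).comp (by fun_prop)) ?_ ?_ ?_
  · filter_upwards [self_mem_nhdsWithin] with l (hl : l ≠ 0)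
    exact Eventually.of_forall (indicator_comp_affine_le hUgood hR (fun y => hM ⟨y, rfl⟩) hC0.le hl)
  · rw [lintegral_indicator_const Metric.isClosed_closedBall.measurableSet]
    exact ENNReal.mul_ne_top (by finiteness) (isCompact_closedBall _ _).measure_ne_top
  · refine Eventually.of_forall fun x => ?_
    have hax := tendsto_add_mul_nhdsNE_zero a x
    have hgx := (hg.tendsto _).comp (tendsto_div_of_hasDerivAt hf x)
    refine (ENNReal.Tendsto.mul (hh.tendsto.comp hax) (Or.inr ENNReal.coe_ne_top)
      (ENNReal.tendsto_coe.2 hgx) (Or.inr hha)).congr' ?_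
    filter_upwards [hax.eventually hU] with l hl
    exact (Set.indicator_of_mem hl fun y => h y * g ((f y - f a) / l)).symm

lemma lintegral_mulHaar_indicator_image_sq {U : Set k} (hU : MeasurableSet U)
    (hUsq : MeasurableSet ((· ^ 2) '' U)) (hUneg : Disjoint U (-U)) {g : k → ℝ≥0∞}
    (hg : Measurable g) :
    ∫⁻ x, ((· ^ 2) '' U).indicator g (x ^ 2) ∂mulHaar μ =
      2 * ∫⁻ x in U, ENNReal.ofReal (modulus x)⁻¹ * g (x ^ 2) ∂μ := by
  set T : Set k := (· ^ 2) '' U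
  set p : k → ℝ≥0∞ := U.indicator fun x => ENNReal.ofReal (modulus x)⁻¹ * g (x ^ 2)
  have hpm : Measurable p := (measurable_ofReal_inv_modulus.mul (by fun_prop)).indicator hU
  have sq_mem_T (x : k) : x ^ 2 ∈ T ↔ x ∈ U ∨ -x ∈ U := by
    constructor
    · rintro ⟨y, hy, hxy⟩
      rcases sq_eq_sq_iff_eq_or_eq_neg.1 hxy with rfl | rfl
      exacts [Or.inl hy, Or.inr (by simpa using hy)]
    · rintro (h | h)
      exacts [⟨x, h, rfl⟩, ⟨-x, h, neg_sq x⟩]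
  have eq_add_neg (x : k) :
      ENNReal.ofReal (modulus x)⁻¹ * T.indicator g (x ^ 2) = p x + p (-x) := by
    by_cases hx : x ∈ U
    · have hx' : -x ∉ U := fun h => Set.disjoint_left.1 hUneg hx h
      simp [p, hx, hx', sq_mem_T]
    · by_cases hx' : -x ∈ U <;> simp [p, hx, hx', sq_mem_T, modulus_neg]
  rw [lintegral_mulHaar μ (f := fun x => T.indicator g (x ^ 2))
    ((hg.indicator hUsq).comp (by fun_prop)), lintegral_congr eq_add_neg, lintegral_add_left hpm,
    lintegral_neg_eq_self p, ← two_mul, lintegral_indicator hU]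

lemma lintegral_mulHaar_comp_sq_mul_setLIntegral_image [NeZero (2 : k)] {F : k → ℝ≥0∞}
    (hF : Measurable F) {U : Set k} (hU : IsOpen U) (hUneg : Disjoint U (-U)) {g : k → ℝ≥0∞}
    (hg : Measurable g) :
    (∫⁻ x, F (x ^ 2) ∂mulHaar μ) * ∫⁻ x in (· ^ 2) '' U, ENNReal.ofReal (modulus x)⁻¹ * g x ∂μ =
      (2 * ∫⁻ x in U, ENNReal.ofReal (modulus x)⁻¹ * g (x ^ 2) ∂μ) *
        ∫⁻ x in nonzeroSquares k, F x ∂mulHaar μ := by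
  have hU0 : (0 : k) ∉ U := fun h => Set.disjoint_left.1 hUneg h (by simpa using h)
  have hT : MeasurableSet ((· ^ 2) '' U) := (isOpen_image_sq hU hU0).measurableSet
  have hTS : (· ^ 2) '' U ⊆ nonzeroSquares k := by
    rintro _ ⟨x, hx, rfl⟩
    exact ⟨x, ne_of_mem_of_not_mem hx hU0, rfl⟩
  rw [← lintegral_mulHaar_indicator_image_sq μ hU.measurableSet hT hUneg hg,
    ← lintegral_mulHaar_sq_mul_lintegral_nonzeroSquares μ hF (hg.indicator hT),
    setLIntegral_indicator hT, Set.inter_eq_self_of_subset_left hTS,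
    setLIntegral_mulHaar μ hT hg]

variable (k) in
lemma exists_hasCompactSupport_lintegral_ne_zero :
    ∃ g : k → NNReal, Continuous g ∧ HasCompactSupport g ∧ ∫⁻ x, g x ∂μ ≠ 0 ∧
      ∫⁻ x, g x ∂μ ≠ ∞ := by
  obtain ⟨f, hfs, hf0, hfne⟩ := exists_continuous_nonneg_pos (0 : k)
  have hpos := f.continuous.integral_pos_of_hasCompactSupport_nonneg_nonzero hfs hf0 hfne (μ := μ)
  have hlint : ∫⁻ x, (f x).toNNReal ∂μ = ENNReal.ofReal (∫ x, f x ∂μ) :=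
    (ofReal_integral_eq_lintegral_ofReal (f.continuous.integrable_of_hasCompactSupport hfs)
      (Eventually.of_forall hf0)).symm
  refine ⟨fun x => (f x).toNNReal, by fun_prop, hfs.comp_left Real.toNNReal_zero, ?_, ?_⟩
  · rw [hlint]
    exact (ENNReal.ofReal_pos.2 hpos).ne'
  · rw [hlint]
    exact ENNReal.ofReal_ne_top

/-- Comparing both sides on functions concentrated near `1`, where squaring is multiplication
by `2` to first order, gives the constant. -/
theorem lintegral_mulHaar_comp_sq [NeZero (2 : k)] {F : k → ℝ≥0∞} (hF : Measurable F) :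
    ∫⁻ x, F (x ^ 2) ∂mulHaar μ =
      ENNReal.ofReal (2 * (modulus (2 : k))⁻¹) * ∫⁻ x in nonzeroSquares k, F x ∂mulHaar μ := by
  obtain ⟨g, hg, hgs, hg0, hgt⟩ := exists_hasCompactSupport_lintegral_ne_zero k μ
  let m : k → ℝ≥0∞ := fun x => ENNReal.ofReal (modulus x)⁻¹
  have hm1 : m 1 = 1 := by simp [m, modulus_one]
  have hmc : ContinuousAt m 1 := ENNReal.continuous_ofReal.continuousAt.comp
    (continuousAt_modulus_one.inv₀ (by simp [modulus_one]))
  have hsq : HasDerivAt (fun x : k => x ^ 2) 2 1 := by simpa using hasDerivAt_pow 2 (1 : k)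
  have hsq1 : Tendsto (fun x : k => x ^ 2) (𝓝 1) (𝓝 1) := by
    simpa using (continuous_pow 2).tendsto (1 : k)
  have eventually_sq := eventually_smallSets_tendsto_setLIntegral_of_hasDerivAt μ hsq two_ne_zero
    (by fun_prop) measurable_ofReal_inv_modulus hmc (by simp) hg hgs
  have eventually_id := eventually_smallSets_tendsto_setLIntegral_of_hasDerivAt μ
    (hasDerivAt_id (1 : k)) one_ne_zero measurable_id measurable_ofReal_inv_modulus hmc
    (by simp) hg hgs
  obtain ⟨ε, hε, hball⟩ := Metric.nhds_basis_ball.smallSets.eventually_iff.1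
    (eventually_sq.and ((hsq1.image_smallSets.eventually eventually_id).and
      eventually_smallSets_disjoint_neg))
  set U := Metric.ball (1 : k) ε
  obtain ⟨limit_U, limit_T, hUneg⟩ := hball (Set.Subset.refl U)
  have hU0 : (0 : k) ∉ U := fun h => Set.disjoint_left.1 hUneg h (by simpa using h)
  set T := (fun x : k => x ^ 2) '' U
  have hTo : IsOpen T := isOpen_image_sq Metric.isOpen_ball hU0
  specialize limit_U (Metric.ball_mem_nhds 1 hε) Metric.isOpen_ball.measurableSet
  specialize limit_T (hTo.mem_nhds ⟨1, Metric.mem_ball_self hε, one_pow 2⟩) hTo.measurableSet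
  simp only [hm1, m, one_pow, one_mul, id_eq] at limit_U limit_T
  have limit_identity : (∫⁻ x, F (x ^ 2) ∂mulHaar μ) * ∫⁻ x, g x ∂μ =
      (2 * ∫⁻ x, g (2 * x) ∂μ) * ∫⁻ x in nonzeroSquares k, F x ∂mulHaar μ := by
    have int_two_ne_zero : 2 * ∫⁻ x, g (2 * x) ∂μ ≠ 0 := by
      rw [lintegral_comp_mul_left μ two_ne_zero fun x => (g x : ℝ≥0∞)]
      simp [hg0, modulus_pos (two_ne_zero (α := k))]
    refine tendsto_nhds_unique (ENNReal.Tendsto.const_mul limit_T (Or.inl hg0))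
      ((ENNReal.Tendsto.mul_const (ENNReal.Tendsto.const_mul limit_U (Or.inr ofNat_ne_top))
        (Or.inl int_two_ne_zero)).congr fun l => ?_)
    rw [mul_left_comm, mul_assoc, ← lintegral_mulHaar_comp_sq_mul_setLIntegral_image μ hF
      Metric.isOpen_ball hUneg (g := fun x => (g ((x - 1) / l) : ℝ≥0∞)) (by fun_prop),
      mul_left_comm]
  rw [lintegral_comp_mul_left μ two_ne_zero fun x => (g x : ℝ≥0∞)] at limit_identity
  refine (ENNReal.mul_left_inj hg0 hgt).1 ?_
  rw [limit_identity, ENNReal.ofReal_mul two_pos.le, ENNReal.ofReal_ofNat]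
  ring

/-- The density `2|2|⁻¹|u|^{-1/2}`, on the nonzero squares, of the image of Haar measure under
squaring. -/
noncomputable def squareDensity (u : k) : ℝ := 2 * (modulus (2 : k))⁻¹ * modulus u ^ (-(1 / 2) : ℝ)

lemma measurable_squareDensity : Measurable (squareDensity : k → ℝ) :=
  (measurable_modulus.pow_const _).const_mul _

theorem map_sq_haar [NeZero (2 : k)] :
    μ.map (fun x => x ^ 2) = (μ.restrict (nonzeroSquares k)).withDensity fun u =>
      ENNReal.ofReal (squareDensity u) := by
  have hmod : Measurable (modulus : k → ℝ) := measurable_modulus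
  have hS : MeasurableSet (nonzeroSquares k) := isOpen_nonzeroSquares.measurableSet
  refine Measure.ext_of_lintegral _ fun f hf => ?_
  have ofReal_inv_mul_rpow (x : k) (hx : x ≠ 0) : ENNReal.ofReal (modulus x)⁻¹ *
      ENNReal.ofReal (modulus x ^ (1 / 2 : ℝ)) = ENNReal.ofReal (modulus x ^ (-(1 / 2) : ℝ)) := by
    rw [← ENNReal.ofReal_mul (inv_nonneg.2 (modulus_nonneg x)), ← Real.rpow_neg_one,
      ← Real.rpow_add (modulus_pos hx)]
    norm_num
  have ofReal_rpow_sq (x : k) :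
      ENNReal.ofReal (modulus (x ^ 2) ^ (1 / 2 : ℝ)) = ENNReal.ofReal (modulus x) := by
    rw [modulus_pow, ← Real.sqrt_eq_rpow, Real.sqrt_sq (modulus_nonneg x)]
  calc ∫⁻ x, f x ∂μ.map (fun x => x ^ 2)
      = ∫⁻ x, ENNReal.ofReal (modulus x)⁻¹ *
          (ENNReal.ofReal (modulus (x ^ 2) ^ (1 / 2 : ℝ)) * f (x ^ 2)) ∂μ := by
        rw [lintegral_map hf (by fun_prop)]
        refine lintegral_congr_ae ?_
        filter_upwards [Measure.ae_ne μ 0] with x hx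
        rw [ofReal_rpow_sq, ← mul_assoc, ← ENNReal.ofReal_mul (inv_nonneg.2 (modulus_nonneg x)),
          inv_mul_cancel₀ (modulus_pos hx).ne', ENNReal.ofReal_one, one_mul]
    _ = ENNReal.ofReal (2 * (modulus (2 : k))⁻¹) * ∫⁻ u in nonzeroSquares k,
          ENNReal.ofReal (modulus u)⁻¹ * (ENNReal.ofReal (modulus u ^ (1 / 2 : ℝ)) * f u) ∂μ := by
        rw [← lintegral_mulHaar μ (by fun_prop), lintegral_mulHaar_comp_sq μ
          (F := fun u => ENNReal.ofReal (modulus u ^ (1 / 2 : ℝ)) * f u) (by fun_prop),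
          setLIntegral_mulHaar μ hS (by fun_prop)]
    _ = _ := by
        rw [lintegral_withDensity_eq_lintegral_mul _ measurable_squareDensity.ennreal_ofReal hf,
          ← lintegral_const_mul' _ _ ENNReal.ofReal_ne_top]
        refine setLIntegral_congr_fun hS ?_
        rintro _ ⟨r, hr, rfl⟩
        have hc : 0 ≤ 2 * (modulus (2 : k))⁻¹ := mul_nonneg two_pos.le (by simp [modulus_nonneg])
        rw [Pi.mul_apply, squareDensity, ENNReal.ofReal_mul hc,
          ← ofReal_inv_mul_rpow _ (pow_ne_zero 2 hr)]
        ring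

end SquareMap

section Coordinates

variable (k V : Type*) [NontriviallyNormedField k] [CompleteSpace k] [AddCommGroup V] [Module k V]
  [FiniteDimensional k V] [TopologicalSpace V] [IsTopologicalAddGroup V]
  [ContinuousSMul k V] [T2Space V]

/-- Coordinates of `V` with respect to a basis, as a homeomorphism; used to transport measures
and compact open sets from `k ^ dim V` to `V`. -/
noncomputable def coords : V ≃L[k] (Fin (Module.finrank k V) → k) :=
  ContinuousLinearEquiv.ofFinrankEq (by simp)

variable {k V}

lemma continuous_bilin (B : LinearMap.BilinForm k V) : Continuous fun p : V × V => B p.1 p.2 := by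
  let b := Module.finBasis k V
  have expand : (fun p : V × V => B p.1 p.2) = fun p => ∑ i, b.coord i p.1 * B (b i) p.2 := by
    ext p
    conv_lhs => rw [← b.sum_repr p.1]
    simp only [map_sum, map_smul, LinearMap.sum_apply, LinearMap.smul_apply, smul_eq_mul,
      Module.Basis.coord_apply]
  have hb (i) : Continuous (b.coord i) := (b.coord i).continuous_of_finiteDimensional
  have hB (i) : Continuous (B (b i)) := (B (b i)).continuous_of_finiteDimensional
  rw [expand]
  fun_prop

lemma continuous_quadraticForm [NeZero (2 : k)] (q : QuadraticForm k V) : Continuous q := by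
  have h : (q : V → k) = fun X => 2⁻¹ * QuadraticMap.polarBilin q X X := by
    ext X
    rw [QuadraticMap.polarBilin_apply_apply, QuadraticMap.polar_self, nsmul_eq_mul,
      Nat.cast_ofNat, inv_mul_cancel_left₀ two_ne_zero]
  rw [h]
  exact continuous_const.mul ((continuous_bilin q.polarBilin).comp
    (by fun_prop : Continuous fun X : V => (X, X)))

end Coordinates

lemma secondCountable_of_finiteDimensional (k V : Type*) [NontriviallyNormedField k]
    [LocallyCompactSpace k] [AddCommGroup V] [Module k V] [FiniteDimensional k V]
    [TopologicalSpace V] [IsTopologicalAddGroup V] [ContinuousSMul k V] [T2Space V] :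
    SecondCountableTopology V :=
  (coords k V).toHomeomorph.secondCountableTopology

section Scaling

variable {k : Type*} [NontriviallyNormedField k] [LocallyCompactSpace k]
  [MeasurableSpace k] [BorelSpace k]

lemma setLIntegral_inv_modulus_sq_lt_top (μ : Measure k) [μ.IsAddHaarMeasure] :
    ∫⁻ t in {t : k | 1 < ‖t‖}, ENNReal.ofReal (modulus t ^ 2)⁻¹ ∂μ < ∞ := by
  set S : Set k := {t | 1 < ‖t‖}
  have hS : MeasurableSet S := measurableSet_lt measurable_const measurable_norm
  set m : k → ℝ≥0∞ := fun t => ENNReal.ofReal (modulus t)⁻¹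
  have hm : Measurable m := measurable_ofReal_inv_modulus
  calc ∫⁻ t in S, ENNReal.ofReal (modulus t ^ 2)⁻¹ ∂μ
      = ∫⁻ t in S, m t * m t ∂μ := by
        refine lintegral_congr fun t => ?_
        rw [← ENNReal.ofReal_mul (inv_nonneg.2 (modulus_nonneg t)), ← mul_inv, sq]
    _ = ∫⁻ t, S.indicator m t⁻¹ ∂mulHaar μ := by
        rw [← setLIntegral_mulHaar μ hS hm, ← lintegral_indicator hS,
          lintegral_mulHaar_comp_inv μ (hm.indicator hS)]
    _ = ∫⁻ t, m t * S.indicator m t⁻¹ ∂μ :=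
        lintegral_mulHaar μ ((hm.indicator hS).comp measurable_inv)
    _ ≤ ∫⁻ t, (Metric.closedBall (0 : k) 1).indicator 1 t ∂μ := by
        refine lintegral_mono fun t => ?_
        by_cases ht : t⁻¹ ∈ S
        swap
        · rw [Set.indicator_of_notMem ht, mul_zero]
          exact zero_le
        have ht0 : t ≠ 0 := by
          rintro rfl
          simp [S, zero_le_one.not_gt] at ht
        have ht1 : t ∈ Metric.closedBall (0 : k) 1 := by
          rw [Set.mem_ofPred_eq, norm_inv, one_lt_inv₀ (norm_pos_iff.2 ht0)] at ht
          simpa using ht.le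
        simp only [Set.indicator_of_mem ht, Set.indicator_of_mem ht1, m, modulus_inv, inv_inv]
        rw [← ENNReal.ofReal_mul (inv_nonneg.2 (modulus_nonneg t)),
          inv_mul_cancel₀ (modulus_pos ht0).ne', ENNReal.ofReal_one, Pi.one_apply]
    _ < ∞ := by
        rw [lintegral_indicator_one Metric.isClosed_closedBall.measurableSet]
        exact (isCompact_closedBall _ _).measure_lt_top

lemma map_smul_pi (ι : Type*) [Fintype ι] (μ : Measure k) [μ.IsAddHaarMeasure] {a : k}
    (ha : a ≠ 0) :
    (Measure.pi fun _ : ι => μ).map (fun x => a • x) =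
      ENNReal.ofReal (modulus a ^ Fintype.card ι)⁻¹ • Measure.pi fun _ : ι => μ := by
  have hp := modulus_pos ha
  have h : (Measure.pi fun _ : ι => μ) = ENNReal.ofReal (modulus a ^ Fintype.card ι) •
      (Measure.pi fun _ : ι => μ).map (fun x => a • x) := by
    refine Measure.pi_eq fun s hs => ?_
    rw [Measure.smul_apply, Measure.map_apply (measurable_const_smul a)
      (MeasurableSet.univ_pi hs)]
    have : (fun x : ι → k => a • x) ⁻¹' Set.univ.pi s =
        Set.univ.pi fun i => (fun x => a * x) ⁻¹' s i := by ext; simp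
    rw [this, Measure.pi_pi]
    have h2 : ∀ i, μ ((fun x => a * x) ⁻¹' s i) = ENNReal.ofReal (modulus a)⁻¹ * μ (s i) := by
      intro i
      rw [← Measure.map_apply (measurable_const_mul a) (hs i), map_mul_left_haar μ ha]
      rfl
    simp_rw [h2]
    rw [Finset.prod_mul_distrib, Finset.prod_const, Finset.card_univ, smul_eq_mul, ← mul_assoc,
      ← ENNReal.ofReal_pow (inv_nonneg.2 hp.le), ← ENNReal.ofReal_mul (by positivity), inv_pow,
      mul_inv_cancel₀ (by positivity), ENNReal.ofReal_one, one_mul]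
  conv_rhs => rw [h]
  rw [smul_smul, ← ENNReal.ofReal_mul (by positivity), inv_mul_cancel₀ (by positivity),
    ENNReal.ofReal_one, one_smul]

variable {V : Type*} [AddCommGroup V] [Module k V] [FiniteDimensional k V]
  [TopologicalSpace V] [IsTopologicalAddGroup V] [ContinuousSMul k V] [T2Space V]
  [MeasurableSpace V] [BorelSpace V]

lemma map_smul_haar (ν : Measure V) [ν.IsAddHaarMeasure] {a : k} (ha : a ≠ 0) :
    ν.map (fun X => a • X) = ENNReal.ofReal (modulus a ^ Module.finrank k V)⁻¹ • ν := by
  let μ : Measure k := Measure.addHaar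
  have : SecondCountableTopology V := secondCountable_of_finiteDimensional k V
  have : LocallyCompactSpace V := LocallyCompactSpace.of_finiteDimensional_of_complete k V
  set e := coords k V
  set ρ : Measure V := (Measure.pi fun _ : Fin (Module.finrank k V) => μ).map e.symm with hρ
  have : ρ.IsAddHaarMeasure := e.symm.isAddHaarMeasure_map _
  have hρs : ρ.map (fun X => a • X) =
      ENNReal.ofReal (modulus a ^ Module.finrank k V)⁻¹ • ρ := by
    have h := map_smul_pi (Fin (Module.finrank k V)) μ ha
    rw [Fintype.card_fin] at h
    rw [hρ, Measure.map_map (measurable_const_smul a) e.symm.continuous.measurable,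
      ← Measure.map_smul, ← h, Measure.map_map e.symm.continuous.measurable
      (measurable_const_smul a)]
    congr 1
    ext x
    simp
  rw [Measure.isAddLeftInvariant_eq_smul ν ρ, Measure.map_smul, hρs, smul_comm]

lemma lintegral_comp_smul (ν : Measure V) [ν.IsAddHaarMeasure] {a : k} (ha : a ≠ 0)
    (f : V → ℝ≥0∞) :
    ∫⁻ X, f (a • X) ∂ν =
      ENNReal.ofReal (modulus a ^ Module.finrank k V)⁻¹ * ∫⁻ X, f X ∂ν := by
  rw [← smul_eq_mul, ← lintegral_smul_measure, ← map_smul_haar ν ha]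
  exact ((Homeomorph.smulOfNeZero a ha).measurableEmbedding.lintegral_map _).symm

end Scaling

section CharacterIntegrals

variable {A : Type*} [AddCommGroup A] {ψ : AddChar A Circle}

lemma conj_char (a : A) : conj (ψ a : ℂ) = ψ (-a) := by
  rw [AddChar.map_neg_eq_inv, Circle.coe_inv_eq_conj]

@[simp]
lemma enorm_char (a : A) : ‖(ψ a : ℂ)‖ₑ = 1 := by
  rw [← ofReal_norm, Circle.norm_coe, ENNReal.ofReal_one]

lemma continuous_char [TopologicalSpace A] (hψ : Continuous ψ) : Continuous fun a => (ψ a : ℂ) :=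
  continuous_subtype_val.comp hψ

lemma measurable_char [TopologicalSpace A] [MeasurableSpace A] [BorelSpace A]
    (hψ : Continuous ψ) : Measurable fun a => (ψ a : ℂ) :=
  (continuous_char hψ).measurable

lemma integrable_mul_char [TopologicalSpace A] [MeasurableSpace A] [BorelSpace A]
    {α : Type*} [MeasurableSpace α] {m : Measure α} (hψ : Continuous ψ)
    {f : α → ℂ} (hf : Integrable f m) {c : α → A} (hc : Measurable c) :
    Integrable (fun x => f x * (ψ (c x) : ℂ)) m :=
  hf.mono (hf.1.mul ((measurable_char hψ).comp hc).aestronglyMeasurable)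
    (Eventually.of_forall fun x => by simp [Circle.norm_coe])

lemma enorm_fourierQuad_le {k V : Type*} [Field k] [AddCommGroup V] [Module k V]
    [MeasurableSpace V] {ν : Measure V} (ψ : AddChar k Circle) (q : QuadraticForm k V)
    (f : V → ℂ) (t : k) :
    ‖fourierQuad ψ q ν f t‖ₑ ≤ ∫⁻ y, ‖f y‖ₑ ∂ν := by
  refine (enorm_integral_le_lintegral_enorm _).trans (le_of_eq ?_)
  simp [enorm_mul]

end CharacterIntegrals

section LinearFourier

variable {k V : Type*} [Field k] [AddCommGroup V] [Module k V] [TopologicalSpace V]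
  [MeasurableSpace V] {ψ : AddChar k Circle} {B : LinearMap.BilinForm k V} {ν : Measure V}
  {φ : V → ℂ}

/-- The class of functions to which Fourier inversion applies: `φ` is continuous and integrable,
and so integrable is its Fourier transform. -/
structure HasIntegrableFourier (ψ : AddChar k Circle) (B : LinearMap.BilinForm k V)
    (ν : Measure V) (φ : V → ℂ) : Prop where
  continuous : Continuous φ
  integrable : Integrable φ ν
  integrable_fourier : Integrable (bilinFourier ψ B ν φ) ν

lemma HasIntegrableFourier.eq_integral (hφ : HasIntegrableFourier ψ B ν φ)
    (hν : IsSelfDual ψ B ν) (X : V) :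
    φ X = ∫ ξ, bilinFourier ψ B ν φ ξ * (ψ (-B ξ X) : ℂ) ∂ν := by
  have h := hν.2 φ hφ.continuous hφ.integrable hφ.integrable_fourier (-X)
  rw [neg_neg] at h
  rw [← h, bilinFourier]
  simp only [map_neg]

end LinearFourier

section Decay

variable {k : Type*} [NontriviallyNormedField k] [LocallyCompactSpace k]
  [MeasurableSpace k] [BorelSpace k]
  {V : Type*} [AddCommGroup V] [Module k V] [FiniteDimensional k V]
  [TopologicalSpace V] [IsTopologicalAddGroup V] [ContinuousSMul k V] [T2Space V]
  [MeasurableSpace V] [BorelSpace V] {ψ : AddChar k Circle} {ν : Measure V}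

lemma continuous_bilinFourier (hψ : Continuous ψ) (B : LinearMap.BilinForm k V) {f : V → ℂ}
    (hf : Integrable f ν) : Continuous (bilinFourier ψ B ν f) := by
  have : SecondCountableTopology V := secondCountable_of_finiteDimensional k V
  have hB := continuous_bilin B
  refine continuous_of_dominated (bound := fun y => ‖f y‖) (fun x => ?_) (fun x => ?_) hf.norm ?_
  · exact (integrable_mul_char hψ hf
      (hB.comp (by fun_prop : Continuous fun y => (y, x))).measurable).1
  · exact Eventually.of_forall fun y => by simp [Circle.norm_coe]
  · refine Eventually.of_forall fun y => continuous_const.mul ?_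
    exact (continuous_char hψ).comp (hB.comp (by fun_prop : Continuous fun x => (y, x)))

lemma enorm_autocorrelation_le (hψ : Continuous ψ) {B : LinearMap.BilinForm k V}
    (hB : ∀ x y, B x y = B y x) (hν : IsSelfDual ψ B ν) {f : V → ℂ}
    (hf : HasIntegrableFourier ψ B ν f) (Z S : V) :
    ‖∫ Y, f (Y + Z) * conj (f Y) * (ψ (B Y S) : ℂ) ∂ν‖ₑ ≤
      ∫⁻ ξ, ‖bilinFourier ψ B ν f ξ‖ₑ * ‖bilinFourier ψ B ν f (ξ - S)‖ₑ ∂ν := by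
  have : SecondCountableTopology V := secondCountable_of_finiteDimensional k V
  have : LocallyCompactSpace V := LocallyCompactSpace.of_finiteDimensional_of_complete k V
  have := hν.1
  set g := bilinFourier ψ B ν f with hg
  have hBc := continuous_bilin B
  have integrable_prod : Integrable (fun p : V × V => conj (f p.1) * g p.2 *
      (ψ (B p.1 S - B p.2 (p.1 + Z)) : ℂ)) (ν.prod ν) := by
    have hfc : Integrable (fun Y => conj (f Y)) ν :=
      Complex.conjLIE.toContinuousLinearEquiv.toContinuousLinearMap.integrable_comp hf.integrable
    refine integrable_mul_char hψ (hfc.mul_prod hf.integrable_fourier) (Continuous.measurable ?_)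
    exact (hBc.comp (by fun_prop : Continuous fun p : V × V => (p.1, S))).sub
      (hBc.comp (by fun_prop : Continuous fun p : V × V => (p.2, p.1 + Z)))
  have insert_inversion : ∫ Y, f (Y + Z) * conj (f Y) * (ψ (B Y S) : ℂ) ∂ν =
      ∫ Y, ∫ ξ, conj (f Y) * g ξ * (ψ (B Y S - B ξ (Y + Z)) : ℂ) ∂ν ∂ν := by
    refine integral_congr_ae (Eventually.of_forall fun Y => ?_)
    simp only
    rw [hf.eq_integral hν (Y + Z), mul_assoc, ← integral_mul_const]
    refine integral_congr_ae (Eventually.of_forall fun ξ => ?_)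
    simp only [sub_eq_add_neg, AddChar.map_add_eq_mul, Circle.coe_mul]
    ring
  have inner_integral (ξ : V) : ∫ Y, conj (f Y) * g ξ * (ψ (B Y S - B ξ (Y + Z)) : ℂ) ∂ν =
      (g ξ * (ψ (-B ξ Z) : ℂ)) * conj (g (ξ - S)) := by
    rw [hg, bilinFourier, bilinFourier, ← integral_conj, ← integral_const_mul]
    refine integral_congr_ae (Eventually.of_forall fun Y => ?_)
    have phase : B Y S - B ξ (Y + Z) = -B ξ Z + -(B Y (ξ - S)) := by
      rw [map_add, map_sub, hB ξ Y]; ring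
    simp only [map_mul, conj_char, phase, AddChar.map_add_eq_mul, Circle.coe_mul]
    ring
  rw [insert_inversion, integral_integral_swap integrable_prod]
  refine (enorm_integral_le_lintegral_enorm _).trans (le_of_eq (lintegral_congr fun ξ => ?_))
  rw [inner_integral]
  simp [enorm_mul]

variable [NeZero (2 : k)]

lemma continuous_fourierQuad (hψ : Continuous ψ) (q : QuadraticForm k V) {f : V → ℂ}
    (hf : Integrable f ν) : Continuous (fourierQuad ψ q ν f) := by
  have hq := continuous_quadraticForm q
  refine continuous_of_dominated (bound := fun y => ‖f y‖) (fun x => ?_) (fun x => ?_) hf.norm ?_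
  · exact (integrable_mul_char hψ hf (by fun_prop : Continuous fun y => x * q y).measurable).1
  · exact Eventually.of_forall fun y => by simp [Circle.norm_coe]
  · refine Eventually.of_forall fun y => continuous_const.mul ?_
    exact (continuous_char hψ).comp (by fun_prop)

lemma fourierQuad_mul_conj [ν.IsAddHaarMeasure] (hψ : Continuous ψ) (q : QuadraticForm k V)
    {φ : V → ℂ} (hφ : Integrable φ ν) (t : k) :
    fourierQuad ψ q ν φ t * conj (fourierQuad ψ q ν φ t) =
      ∫ Z, (ψ (t * q Z) : ℂ) * ∫ Y, φ (Y + Z) * conj (φ Y) *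
        (ψ (QuadraticMap.polarBilin q Y (t • Z)) : ℂ) ∂ν ∂ν := by
  have : SecondCountableTopology V := secondCountable_of_finiteDimensional k V
  have : LocallyCompactSpace V := LocallyCompactSpace.of_finiteDimensional_of_complete k V
  have hqc := continuous_quadraticForm q
  have integrable_prod : Integrable (fun p : V × V => conj (φ p.1) * φ (p.1 + p.2) *
      (ψ (t * q (p.1 + p.2) - t * q p.1) : ℂ)) (ν.prod ν) := by
    have hφc : Integrable (fun Y => conj (φ Y)) ν :=
      Complex.conjLIE.toContinuousLinearEquiv.toContinuousLinearMap.integrable_comp hφ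
    refine integrable_mul_char hψ ?_ (Continuous.measurable (by fun_prop))
    exact (measurePreserving_prod_add ν ν).integrable_comp_of_integrable (hφc.mul_prod hφ)
  calc fourierQuad ψ q ν φ t * conj (fourierQuad ψ q ν φ t)
      = ∫ Y, ∫ Z, conj (φ Y) * φ (Y + Z) * (ψ (t * q (Y + Z) - t * q Y) : ℂ) ∂ν ∂ν := by
        rw [fourierQuad, ← integral_conj, ← integral_const_mul]
        refine integral_congr_ae (Eventually.of_forall fun Y => ?_)
        simp only
        rw [← integral_mul_const, ← integral_add_left_eq_self
          (fun X => φ X * (ψ (t * q X) : ℂ) * conj (φ Y * (ψ (t * q Y) : ℂ))) Y]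
        refine integral_congr_ae (Eventually.of_forall fun Z => ?_)
        simp only [map_mul, conj_char, sub_eq_add_neg, AddChar.map_add_eq_mul, Circle.coe_mul]
        ring
    _ = ∫ Z, ∫ Y, conj (φ Y) * φ (Y + Z) * (ψ (t * q (Y + Z) - t * q Y) : ℂ) ∂ν ∂ν :=
        integral_integral_swap integrable_prod
    _ = _ := by
        refine integral_congr_ae (Eventually.of_forall fun Z => ?_)
        simp only
        rw [← integral_const_mul]
        refine integral_congr_ae (Eventually.of_forall fun Y => ?_)
        have phase : t * q (Y + Z) - t * q Y = t * q Z + QuadraticMap.polarBilin q Y (t • Z) := by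
          simp only [map_smul, QuadraticMap.polarBilin_apply_apply, QuadraticMap.polar,
            smul_eq_mul]
          ring
        simp only [phase, AddChar.map_add_eq_mul, Circle.coe_mul]
        ring

/-- `|ℱ_q φ(t)|²` is a Fourier integral of autocorrelations of `φ`, each of which is bounded by
an autocorrelation of `φ̂` at scale `t`. -/
theorem enorm_fourierQuad_sq_le (hψ : Continuous ψ) (q : QuadraticForm k V)
    (hν : IsSelfDual ψ (QuadraticMap.polarBilin q) ν) {φ : V → ℂ}
    (hφ : HasIntegrableFourier ψ (QuadraticMap.polarBilin q) ν φ) {t : k} (ht : t ≠ 0) :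
    ‖fourierQuad ψ q ν φ t‖ₑ ^ 2 ≤ ENNReal.ofReal (modulus t ^ Module.finrank k V)⁻¹ *
      (∫⁻ X, ‖bilinFourier ψ (QuadraticMap.polarBilin q) ν φ X‖ₑ ∂ν) ^ 2 := by
  have : SecondCountableTopology V := secondCountable_of_finiteDimensional k V
  have : LocallyCompactSpace V := LocallyCompactSpace.of_finiteDimensional_of_complete k V
  have := hν.1
  set B := QuadraticMap.polarBilin q with hB
  have B_symm (x y) : B x y = B y x := by simp [hB, QuadraticMap.polar_comm]
  set g := bilinFourier ψ B ν φ
  have hgc : Continuous g := continuous_bilinFourier hψ B hφ.integrable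
  calc ‖fourierQuad ψ q ν φ t‖ₑ ^ 2
      = ‖fourierQuad ψ q ν φ t * conj (fourierQuad ψ q ν φ t)‖ₑ := by
        rw [enorm_mul, sq]
        congr 1
        simp [enorm_eq_nnnorm]
    _ ≤ ∫⁻ Z, ∫⁻ ξ, ‖g ξ‖ₑ * ‖g (ξ - t • Z)‖ₑ ∂ν ∂ν := by
        rw [fourierQuad_mul_conj hψ q hφ.integrable]
        refine (enorm_integral_le_lintegral_enorm _).trans (lintegral_mono fun Z => ?_)
        rw [enorm_mul, enorm_char, one_mul]
        exact enorm_autocorrelation_le hψ B_symm hν hφ Z (t • Z)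
    _ = ∫⁻ ξ, ∫⁻ Z, ‖g ξ‖ₑ * ‖g (ξ - t • Z)‖ₑ ∂ν ∂ν := by
        refine lintegral_lintegral_swap (Measurable.aemeasurable ?_)
        exact (hgc.enorm.measurable.comp measurable_snd).mul (Continuous.measurable
          (by fun_prop : Continuous fun p : V × V => ‖g (p.2 - t • p.1)‖ₑ))
    _ = ∫⁻ ξ, ‖g ξ‖ₑ * (ENNReal.ofReal (modulus t ^ Module.finrank k V)⁻¹ *
          ∫⁻ X, ‖g X‖ₑ ∂ν) ∂ν := by
        refine lintegral_congr fun ξ => ?_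
        rw [lintegral_const_mul _ (Continuous.measurable (by fun_prop)),
          lintegral_comp_smul ν ht (fun Z => ‖g (ξ - Z)‖ₑ),
          lintegral_sub_left_eq_self (fun Z => ‖g Z‖ₑ) ξ]
    _ = _ := by
        rw [lintegral_mul_const _ hgc.enorm.measurable]
        ring

theorem lintegral_fourierQuad_sq_lt_top (hψ : Continuous ψ) (q : QuadraticForm k V)
    (hV : 2 ≤ Module.finrank k V) (μ : Measure k) [μ.IsAddHaarMeasure]
    (hν : IsSelfDual ψ (QuadraticMap.polarBilin q) ν) {φ : V → ℂ}
    (hφ : HasIntegrableFourier ψ (QuadraticMap.polarBilin q) ν φ) :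
    ∫⁻ t, ‖fourierQuad ψ q ν φ t‖ₑ ^ 2 ∂μ < ∞ := by
  have hS : MeasurableSet {t : k | 1 < ‖t‖} := measurableSet_lt measurable_const measurable_norm
  rw [← lintegral_add_compl _ hS]
  refine ENNReal.add_lt_top.2 ⟨?_, ?_⟩
  · set C := (∫⁻ X, ‖bilinFourier ψ (QuadraticMap.polarBilin q) ν φ X‖ₑ ∂ν) ^ 2
    have hCt : C ≠ ∞ := pow_ne_top hφ.integrable_fourier.2.ne
    calc ∫⁻ t in {t : k | 1 < ‖t‖}, ‖fourierQuad ψ q ν φ t‖ₑ ^ 2 ∂μ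
        ≤ ∫⁻ t in {t : k | 1 < ‖t‖}, ENNReal.ofReal (modulus t ^ 2)⁻¹ * C ∂μ := by
          refine setLIntegral_mono_ae' hS (Eventually.of_forall fun t ht => ?_)
          have ht1 : 1 < ‖t‖ := ht
          have ht0 : t ≠ 0 := norm_pos_iff.1 (zero_lt_one.trans ht1)
          refine (enorm_fourierQuad_sq_le hψ q hν hφ ht0).trans ?_
          have := one_le_modulus ht1.le
          have := modulus_pos ht0
          gcongr
      _ < ∞ := by
          rw [lintegral_mul_const' _ _ hCt]
          exact ENNReal.mul_lt_top (setLIntegral_inv_modulus_sq_lt_top μ) hCt.lt_top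
  · have hsub : {t : k | 1 < ‖t‖}ᶜ ⊆ Metric.closedBall (0 : k) 1 := fun t ht => by
      simpa using ht
    calc ∫⁻ t in {t : k | 1 < ‖t‖}ᶜ, ‖fourierQuad ψ q ν φ t‖ₑ ^ 2 ∂μ
        ≤ ∫⁻ _ in {t : k | 1 < ‖t‖}ᶜ, (∫⁻ y, ‖φ y‖ₑ ∂ν) ^ 2 ∂μ :=
          lintegral_mono fun t => by gcongr; exact enorm_fourierQuad_le ψ q φ t
      _ < ∞ := by
          rw [setLIntegral_const]
          exact ENNReal.mul_lt_top (pow_lt_top hφ.integrable.2)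
            ((measure_mono hsub).trans_lt (isCompact_closedBall _ _).measure_lt_top)

end Decay

section Summation

lemma lintegral_mul_comp_add_right_le {A : Type*} [AddGroup A] [MeasurableSpace A]
    [MeasurableAdd A] {m : Measure A} [m.IsAddRightInvariant] {f : A → ℝ≥0∞} (hf : Measurable f)
    (a : A) : ∫⁻ x, f x * f (x + a) ∂m ≤ ∫⁻ x, f x ^ 2 ∂m := by
  have h := ENNReal.lintegral_mul_le_Lp_mul_Lq m Real.HolderConjugate.two_two
    (f := f) (g := fun x => f (x + a)) (by fun_prop) (by fun_prop)
  simp only [ENNReal.rpow_ofNat, Pi.mul_apply,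
    lintegral_add_right_eq_self (fun x => f x ^ 2) a] at h
  rwa [← ENNReal.rpow_add_of_nonneg _ _ (by norm_num) (by norm_num), add_halves,
    ENNReal.rpow_one] at h

variable {k : Type*} [NontriviallyNormedField k] [MeasurableSpace k] {ψ : AddChar k Circle}
  {μ : Measure k} {G K : k → ℂ}

/-- The Fourier transform on `k` for the pairing `ψ(xy)`. -/
noncomputable def fourierField (ψ : AddChar k Circle) (μ : Measure k) (G : k → ℂ) : k → ℂ :=
  bilinFourier ψ (LinearMap.mul k k) μ G

lemma fourierField_apply (G : k → ℂ) (t : k) :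
    fourierField ψ μ G t = ∫ y, G y * (ψ (y * t) : ℂ) ∂μ := rfl

lemma fourierField_congr_ae {G' : k → ℂ} (h : G =ᵐ[μ] G') :
    fourierField ψ μ G = fourierField ψ μ G' := by
  ext t
  refine integral_congr_ae ?_
  filter_upwards [h] with x hx
  rw [hx]

lemma conj_fourierField (t : k) :
    conj (fourierField ψ μ G t) = ∫ x, conj (G x) * (ψ (-t * x) : ℂ) ∂μ := by
  rw [fourierField_apply, ← integral_conj]
  refine integral_congr_ae (Eventually.of_forall fun x => ?_)
  simp only [map_mul, conj_char, neg_mul, mul_comm t]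

/-- A summation kernel: a nonnegative function bounded by `K 0 = 1` to which Fourier inversion
applies. Inserting `K (l * t)` and letting `l → 0` gives meaning to Fourier integrals that
do not converge absolutely. Nonnegativity is encoded as `‖K x‖ = K x`. -/
structure IsSummationKernel (ψ : AddChar k Circle) (μ : Measure k) (K : k → ℂ) : Prop
    extends HasIntegrableFourier ψ (LinearMap.mul k k) μ K where
  norm_le : ∀ x, ‖K x‖ ≤ 1
  ofReal_norm : ∀ x, ((‖K x‖ : ℝ) : ℂ) = K x
  apply_zero : K 0 = 1

lemma integral_fourierField_kernel (hSD : IsSelfDual ψ (LinearMap.mul k k) μ)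
    (hK : IsSummationKernel ψ μ K) : ∫ z, fourierField ψ μ K z ∂μ = 1 := by
  rw [← hK.apply_zero, hK.eq_integral hSD 0]
  simp [fourierField]

lemma tendsto_kernel (hK : IsSummationKernel ψ μ K) (t : k) :
    Tendsto (fun l : k => K (l * t)) (𝓝[≠] 0) (𝓝 1) := by
  have hc := hK.continuous
  have h : Tendsto (fun l : k => K (l * t)) (𝓝 0) (𝓝 (K (0 * t))) :=
    Continuous.tendsto (by fun_prop) 0
  rw [zero_mul, hK.apply_zero] at h
  exact h.mono_left nhdsWithin_le_nhds


section ApproximateIdentity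

variable {g κ : k → ℂ} {C : ℝ}

lemma norm_integral_comp_add_mul_mul_le (hκ : Integrable κ μ) (hC : ∀ x, ‖g x‖ ≤ C) (u l : k) :
    ‖∫ z, g (u + l * z) * κ z ∂μ‖ ≤ C * ∫ z, ‖κ z‖ ∂μ := by
  rw [← integral_const_mul]
  refine norm_integral_le_of_norm_le (hκ.norm.const_mul C) (Eventually.of_forall fun z => ?_)
  rw [norm_mul]
  gcongr
  exact hC _

variable [BorelSpace k]

lemma tendsto_integral_comp_add_mul_mul (hκ : Integrable κ μ) (hg : Continuous g)
    (hC : ∀ x, ‖g x‖ ≤ C) (u : k) :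
    Tendsto (fun l : k => ∫ z, g (u + l * z) * κ z ∂μ) (𝓝[≠] 0) (𝓝 (g u * ∫ z, κ z ∂μ)) := by
  rw [← integral_const_mul]
  refine tendsto_integral_filter_of_dominated_convergence (fun z => C * ‖κ z‖)
    (Eventually.of_forall fun l =>
      (by fun_prop : Continuous fun z => g (u + l * z)).aestronglyMeasurable.mul hκ.1)
    (Eventually.of_forall fun l => Eventually.of_forall fun z => ?_)
    (hκ.norm.const_mul C) (Eventually.of_forall fun z => ?_)
  · rw [norm_mul]
    gcongr
    exact hC _
  · have h : Tendsto (fun l : k => g (u + l * z)) (𝓝 0) (𝓝 (g (u + 0 * z))) :=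
      Continuous.tendsto (by fun_prop) 0
    rw [zero_mul, add_zero] at h
    exact (h.mono_left nhdsWithin_le_nhds).mul_const _

lemma tendsto_integral_mul_integral_comp_add_mul_mul [LocallyCompactSpace k] [SFinite μ]
    (hκ : Integrable κ μ) (hκm : Measurable κ) (hg : Continuous g) (hC : ∀ x, ‖g x‖ ≤ C)
    {X : Type*} [MeasurableSpace X] {ν : Measure X} {φ : X → ℂ} (hφ : Integrable φ ν)
    {p : X → k} (hp : Measurable p) :
    Tendsto (fun l : k => ∫ x, φ x * ∫ z, g (p x + l * z) * κ z ∂μ ∂ν) (𝓝[≠] 0)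
      (𝓝 (∫ x, φ x * (g (p x) * ∫ z, κ z ∂μ) ∂ν)) := by
  refine tendsto_integral_filter_of_dominated_convergence
    (fun x => ‖φ x‖ * (C * ∫ z, ‖κ z‖ ∂μ)) (Eventually.of_forall fun l => hφ.1.mul ?_)
    (Eventually.of_forall fun l => Eventually.of_forall fun x => ?_) (hφ.norm.mul_const _)
    (Eventually.of_forall fun x => (tendsto_integral_comp_add_mul_mul hκ hg hC _).const_mul _)
  · have hm : StronglyMeasurable fun y : X × k => g (p y.1 + l * y.2) * κ y.2 :=
      ((hg.measurable.comp (by fun_prop)).mul (hκm.comp measurable_snd)).stronglyMeasurable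
    exact hm.integral_prod_right.aestronglyMeasurable
  · rw [norm_mul]
    gcongr
    exact norm_integral_comp_add_mul_mul_le hκ hC _ _

end ApproximateIdentity

variable [BorelSpace k]

lemma tendsto_integral_mul_kernel {f : k → ℂ} (hK : IsSummationKernel ψ μ K)
    (hf : Integrable f μ) :
    Tendsto (fun l : k => ∫ t, f t * K (l * t) ∂μ) (𝓝[≠] 0) (𝓝 (∫ t, f t ∂μ)) := by
  have hKc := hK.continuous
  refine tendsto_integral_filter_of_dominated_convergence (fun t => ‖f t‖)
    (Eventually.of_forall fun l => hf.1.mul (Continuous.aestronglyMeasurable (by fun_prop)))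
    (Eventually.of_forall fun l => Eventually.of_forall fun t => ?_) hf.norm
    (Eventually.of_forall fun t => ?_)
  · rw [norm_mul]
    exact mul_le_of_le_one_right (norm_nonneg _) (hK.norm_le _)
  · simpa using (tendsto_kernel hK t).const_mul (f t)

variable [LocallyCompactSpace k]

lemma continuous_fourierField (hψ : Continuous ψ) (hG : Integrable G μ) :
    Continuous (fourierField ψ μ G) :=
  continuous_bilinFourier hψ _ hG

lemma integrable_mul_fourierField (hψ : Continuous ψ) {h : k → ℂ} (hG : Integrable G μ)
    (hh : Integrable h μ) : Integrable (fun t => fourierField ψ μ G t * h t) μ := by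
  refine hh.bdd_mul (c := ∫ y, ‖G y‖ ∂μ)
    (continuous_fourierField hψ hG).aestronglyMeasurable (Eventually.of_forall fun t => ?_)
  refine (norm_integral_le_integral_norm _).trans (le_of_eq ?_)
  simp [Circle.norm_coe]

variable [μ.IsAddHaarMeasure] {X : Type*} [MeasurableSpace X] {ν : Measure X}

lemma integral_fourierField_mul_kernel (hψ : Continuous ψ) (hK : IsSummationKernel ψ μ K)
    (hG : Integrable G μ) {l : k} (hl : l ≠ 0) (u : k) :
    ∫ t, fourierField ψ μ G t * K (l * t) * (ψ (-(t * u)) : ℂ) ∂μ =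
      ∫ z, G (u + l * z) * fourierField ψ μ K z ∂μ := by
  have hKl : Integrable (fun t => K (l * t)) μ := integrable_comp_mul_left μ hl hK.integrable
  have hprod : Integrable (fun p : k × k => K (l * p.1) * G p.2 *
      (ψ (p.2 * p.1 - p.1 * u) : ℂ)) (μ.prod μ) :=
    integrable_mul_char hψ (hKl.mul_prod hG) (Continuous.measurable (by fun_prop))
  calc ∫ t, fourierField ψ μ G t * K (l * t) * (ψ (-(t * u)) : ℂ) ∂μ
      = ∫ t, ∫ y, K (l * t) * G y * (ψ (y * t - t * u) : ℂ) ∂μ ∂μ := by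
        refine integral_congr_ae (Eventually.of_forall fun t => ?_)
        simp only
        rw [fourierField_apply, mul_assoc, ← integral_mul_const]
        refine integral_congr_ae (Eventually.of_forall fun y => ?_)
        simp only
        rw [sub_eq_add_neg, AddChar.map_add_eq_mul, Circle.coe_mul]
        ring
    _ = ∫ y, ∫ t, K (l * t) * G y * (ψ (y * t - t * u) : ℂ) ∂μ ∂μ := integral_integral_swap hprod
    _ = ∫ y, ((modulus l)⁻¹ : ℝ) * (G y * fourierField ψ μ K (l⁻¹ * (y - u))) ∂μ := by
        refine integral_congr_ae (Eventually.of_forall fun y => ?_)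
        have h := integral_comp_mul_left μ hl
          (fun t => K t * (ψ (t * (l⁻¹ * (y - u))) : ℂ))
        simp only
        rw [mul_left_comm, fourierField_apply, ← h, ← integral_const_mul]
        refine integral_congr_ae (Eventually.of_forall fun t => ?_)
        have : l * t * (l⁻¹ * (y - u)) = y * t - t * u := by field_simp
        simp only
        rw [this]
        ring
    _ = ∫ z, G (u + l * z) * fourierField ψ μ K z ∂μ := by
        rw [integral_const_mul, ← integral_add_left_eq_self _ u, ← integral_comp_mul_left μ hl]
        refine integral_congr_ae (Eventually.of_forall fun z => ?_)
        simp only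
        rw [add_sub_cancel_left, inv_mul_cancel_left₀ hl]

lemma integral_fourierField_mul_integral_mul_kernel [SFinite ν] (hψ : Continuous ψ)
    (hK : IsSummationKernel ψ μ K) (hG : Integrable G μ) {φ : X → ℂ}
    (hφ : Integrable φ ν) {p : X → k} (hp : Measurable p) {l : k} (hl : l ≠ 0) :
    ∫ t, fourierField ψ μ G t * (∫ x, φ x * (ψ (-t * p x) : ℂ) ∂ν) * K (l * t) ∂μ =
      ∫ x, φ x * ∫ z, G (p x + l * z) * fourierField ψ μ K z ∂μ ∂ν := by
  have hKl : Integrable (fun t => K (l * t)) μ := integrable_comp_mul_left μ hl hK.integrable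
  have hprod : Integrable (fun y : k × X => fourierField ψ μ G y.1 * K (l * y.1) * φ y.2 *
      (ψ (-(y.1 * p y.2)) : ℂ)) (μ.prod ν) :=
    integrable_mul_char hψ ((integrable_mul_fourierField hψ hG hKl).mul_prod hφ) (by fun_prop)
  calc ∫ t, fourierField ψ μ G t * (∫ x, φ x * (ψ (-t * p x) : ℂ) ∂ν) * K (l * t) ∂μ
      = ∫ t, ∫ x, fourierField ψ μ G t * K (l * t) * φ x * (ψ (-(t * p x)) : ℂ) ∂ν ∂μ := by
        refine integral_congr_ae (Eventually.of_forall fun t => ?_)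
        simp only
        rw [mul_right_comm, ← integral_const_mul]
        refine integral_congr_ae (Eventually.of_forall fun x => ?_)
        simp only [neg_mul]
        ring
    _ = ∫ x, ∫ t, fourierField ψ μ G t * K (l * t) * φ x * (ψ (-(t * p x)) : ℂ) ∂μ ∂ν :=
        integral_integral_swap hprod
    _ = _ := by
        refine integral_congr_ae (Eventually.of_forall fun x => ?_)
        simp only
        rw [← integral_fourierField_mul_kernel hψ hK hG hl, ← integral_const_mul]
        refine integral_congr_ae (Eventually.of_forall fun t => ?_)
        simp only
        ring

/-- Fourier inversion `∫ ĝ(t) ψ(-t u) dt = g(u)` integrated against the image of `φ` under `p`;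
it needs `ĝ` to be integrable only after multiplication by the transform of that image. -/
theorem integral_fourierField_mul_integral [SFinite ν] (hψ : Continuous ψ)
    (hSD : IsSelfDual ψ (LinearMap.mul k k) μ)
    (hK : IsSummationKernel ψ μ K) {g : k → ℂ} (hgc : Continuous g) (hg : Integrable g μ)
    {C : ℝ} (hC : ∀ x, ‖g x‖ ≤ C) {φ : X → ℂ} (hφ : Integrable φ ν) {p : X → k}
    (hp : Measurable p)
    (hprod : Integrable (fun t => fourierField ψ μ g t * ∫ x, φ x * (ψ (-t * p x) : ℂ) ∂ν) μ) :
    ∫ t, fourierField ψ μ g t * (∫ x, φ x * (ψ (-t * p x) : ℂ) ∂ν) ∂μ =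
      ∫ x, φ x * g (p x) ∂ν := by
  have hlim := tendsto_integral_mul_integral_comp_add_mul_mul (κ := fourierField ψ μ K)
    hK.integrable_fourier (continuous_fourierField hψ hK.integrable).measurable hgc hC hφ hp
  simp only [integral_fourierField_kernel hSD hK, mul_one] at hlim
  refine tendsto_nhds_unique (tendsto_integral_mul_kernel hK hprod) (hlim.congr' ?_)
  filter_upwards [self_mem_nhdsWithin] with l (hl : l ≠ 0)
  exact (integral_fourierField_mul_integral_mul_kernel hψ hK hg hφ hp hl).symm

lemma enorm_integral_fourierField_sq_mul_kernel_le (hψ : Continuous ψ)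
    (hK : IsSummationKernel ψ μ K) (hGm : Measurable G) (hG : Integrable G μ) {l : k}
    (hl : l ≠ 0) :
    ‖∫ t, fourierField ψ μ G t * conj (fourierField ψ μ G t) * K (l * t) ∂μ‖ₑ ≤
      (∫⁻ z, ‖fourierField ψ μ K z‖ₑ ∂μ) * ∫⁻ x, ‖G x‖ₑ ^ 2 ∂μ := by
  have hKhc : Continuous (fourierField ψ μ K) := continuous_fourierField hψ hK.integrable
  have hconj : Integrable (fun Y => conj (G Y)) μ :=
    Complex.conjLIE.toContinuousLinearEquiv.toContinuousLinearMap.integrable_comp hG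
  simp_rw [conj_fourierField]
  calc ‖∫ t, fourierField ψ μ G t * (∫ x, conj (G x) * (ψ (-t * x) : ℂ) ∂μ) * K (l * t) ∂μ‖ₑ
      = ‖∫ x, conj (G x) * ∫ z, G (x + l * z) * fourierField ψ μ K z ∂μ ∂μ‖ₑ :=
        congrArg _ (integral_fourierField_mul_integral_mul_kernel (p := fun x => x) hψ hK hG hconj
          measurable_id hl)
    _ ≤ ∫⁻ x, ‖G x‖ₑ * ∫⁻ z, ‖G (x + l * z)‖ₑ * ‖fourierField ψ μ K z‖ₑ ∂μ ∂μ := by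
        refine (enorm_integral_le_lintegral_enorm _).trans (lintegral_mono fun x => ?_)
        rw [enorm_mul]
        gcongr
        · simp [enorm_eq_nnnorm]
        · refine (enorm_integral_le_lintegral_enorm _).trans (le_of_eq ?_)
          simp [enorm_mul]
    _ = ∫⁻ x, ∫⁻ z, ‖fourierField ψ μ K z‖ₑ * (‖G x‖ₑ * ‖G (x + l * z)‖ₑ) ∂μ ∂μ := by
        refine lintegral_congr fun x => ?_
        rw [← lintegral_const_mul _ (by fun_prop)]
        refine lintegral_congr fun z => ?_
        ring
    _ = ∫⁻ z, ∫⁻ x, ‖fourierField ψ μ K z‖ₑ * (‖G x‖ₑ * ‖G (x + l * z)‖ₑ) ∂μ ∂μ :=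
        lintegral_lintegral_swap (by fun_prop)
    _ ≤ ∫⁻ z, ‖fourierField ψ μ K z‖ₑ * ∫⁻ x, ‖G x‖ₑ ^ 2 ∂μ ∂μ := by
        refine lintegral_mono fun z => ?_
        rw [lintegral_const_mul _ (by fun_prop)]
        exact mul_le_mul_right (lintegral_mul_comp_add_right_le hGm.enorm _) _
    _ = _ := lintegral_mul_const _ (by fun_prop)

lemma lintegral_fourierField_sq_mul_kernel_eq (hψ : Continuous ψ)
    (hK : IsSummationKernel ψ μ K) (hG : Integrable G μ) {l : k} (hl : l ≠ 0) :
    ∫⁻ t, ‖fourierField ψ μ G t‖ₑ ^ 2 * ‖K (l * t)‖ₑ ∂μ =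
      ‖∫ t, fourierField ψ μ G t * conj (fourierField ψ μ G t) * K (l * t) ∂μ‖ₑ := by
  have hKl : Integrable (fun t => K (l * t)) μ := integrable_comp_mul_left μ hl hK.integrable
  have hI : Integrable (fun t => ‖fourierField ψ μ G t‖ ^ 2 * ‖K (l * t)‖) μ := by
    refine (integrable_mul_fourierField hψ hG (integrable_mul_fourierField hψ hG hKl)).norm.congr
      (Eventually.of_forall fun t => ?_)
    simp only [norm_mul]
    ring
  have integral_eq : ∫ t, fourierField ψ μ G t * conj (fourierField ψ μ G t) * K (l * t) ∂μ =
      ((∫ t, ‖fourierField ψ μ G t‖ ^ 2 * ‖K (l * t)‖ ∂μ : ℝ) : ℂ) := by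
    rw [← integral_complex_ofReal]
    refine integral_congr_ae (Eventually.of_forall fun t => ?_)
    simp only [Complex.mul_conj, Complex.normSq_eq_norm_sq]
    push_cast
    rw [hK.ofReal_norm]
  have nonneg : 0 ≤ ∫ t, ‖fourierField ψ μ G t‖ ^ 2 * ‖K (l * t)‖ ∂μ :=
    integral_nonneg fun t => by positivity
  rw [integral_eq, ← ofReal_norm, Complex.norm_real, Real.norm_of_nonneg nonneg,
    ofReal_integral_eq_lintegral_ofReal hI (Eventually.of_forall fun t => by positivity)]
  refine lintegral_congr fun t => ?_
  rw [ENNReal.ofReal_mul (by positivity), ENNReal.ofReal_pow (norm_nonneg _), ofReal_norm,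
    ofReal_norm]

lemma lintegral_fourierField_sq_le_of_measurable (hψ : Continuous ψ)
    (hK : IsSummationKernel ψ μ K) (hGm : Measurable G) (hG : Integrable G μ) :
    ∫⁻ t, ‖fourierField ψ μ G t‖ₑ ^ 2 ∂μ ≤
      (∫⁻ z, ‖fourierField ψ μ K z‖ₑ ∂μ) * ∫⁻ x, ‖G x‖ₑ ^ 2 ∂μ := by
  have hGhc : Continuous (fourierField ψ μ G) := continuous_fourierField hψ hG
  have hKc := hK.continuous
  obtain ⟨l, hl⟩ := exists_seq_tendsto (𝓝[≠] (0 : k))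
  have hl0 : ∀ᶠ n in atTop, l n ≠ 0 := hl.eventually self_mem_nhdsWithin
  calc ∫⁻ t, ‖fourierField ψ μ G t‖ₑ ^ 2 ∂μ
      = ∫⁻ t, liminf (fun n => ‖fourierField ψ μ G t‖ₑ ^ 2 * ‖K (l n * t)‖ₑ) atTop ∂μ := by
        refine lintegral_congr fun t => ?_
        have hKt : Tendsto (fun n => ‖K (l n * t)‖ₑ) atTop (𝓝 1) := by
          simpa using ((tendsto_kernel hK t).comp hl).enorm
        have hprod := ENNReal.Tendsto.const_mul (a := ‖fourierField ψ μ G t‖ₑ ^ 2) hKt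
          (Or.inl one_ne_zero)
        rw [mul_one] at hprod
        exact hprod.liminf_eq.symm
    _ ≤ liminf (fun n => ∫⁻ t, ‖fourierField ψ μ G t‖ₑ ^ 2 * ‖K (l n * t)‖ₑ ∂μ) atTop :=
        lintegral_liminf_le fun n => Measurable.mul (hGhc.enorm.measurable.pow_const 2)
          (Continuous.measurable (by fun_prop))
    _ ≤ _ := by
        refine liminf_le_of_le (by isBoundedDefault) fun b hb => ?_
        obtain ⟨n, hn, hn0⟩ := (hb.and hl0).exists
        rw [lintegral_fourierField_sq_mul_kernel_eq hψ hK hG hn0] at hn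
        exact hn.trans (enorm_integral_fourierField_sq_mul_kernel_le hψ hK hGm hG hn0)

theorem lintegral_fourierField_sq_le (hψ : Continuous ψ) (hK : IsSummationKernel ψ μ K)
    (hG : Integrable G μ) :
    ∫⁻ t, ‖fourierField ψ μ G t‖ₑ ^ 2 ∂μ ≤
      (∫⁻ z, ‖fourierField ψ μ K z‖ₑ ∂μ) * ∫⁻ x, ‖G x‖ₑ ^ 2 ∂μ := by
  have hG' := hG.aestronglyMeasurable
  have hae : G =ᵐ[μ] hG'.mk G := hG'.ae_eq_mk
  calc ∫⁻ t, ‖fourierField ψ μ G t‖ₑ ^ 2 ∂μ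
      = ∫⁻ t, ‖fourierField ψ μ (hG'.mk G) t‖ₑ ^ 2 ∂μ := by rw [fourierField_congr_ae hae]
    _ ≤ (∫⁻ z, ‖fourierField ψ μ K z‖ₑ ∂μ) * ∫⁻ x, ‖hG'.mk G x‖ₑ ^ 2 ∂μ :=
        lintegral_fourierField_sq_le_of_measurable hψ hK hG'.stronglyMeasurable_mk.measurable
          (hG.congr hae)
    _ = _ := by
        congr 1
        exact lintegral_congr_ae (hae.mono fun x hx => by simp only [hx])

end Summation

section MeasureBound

variable {α : Type*} [MetricSpace α] [ProperSpace α] [MeasurableSpace α] [BorelSpace α]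
  {μ m : Measure α} {p C : ℝ≥0∞}

lemma measure_le_of_forall_hasCompactSupport [IsFiniteMeasure m] (hp0 : p ≠ 0) (hp : p ≠ ∞)
    (h : ∀ g : α → ℂ, Continuous g → HasCompactSupport g →
      ∫⁻ x, ‖g x‖ₑ ∂m ≤ C * eLpNorm g p μ) {U : Set α} (hU : IsOpen U) :
    m U ≤ C * μ U ^ (1 / p.toReal) := by
  rw [hU.measure_eq_iSup_isCompact]
  refine iSup₂_le fun T hT => iSup_le fun hTc => ?_
  obtain ⟨f, hf1, hf0, hfc, hf01⟩ := exists_continuous_one_zero_of_isCompact hTc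
    hU.isClosed_compl (Set.disjoint_compl_right_iff_subset.2 hT)
  calc m T = ∫⁻ x, T.indicator 1 x ∂m := (lintegral_indicator_one hTc.measurableSet).symm
    _ ≤ ∫⁻ x, ‖(f x : ℂ)‖ₑ ∂m := by
        refine lintegral_mono fun x => ?_
        by_cases hx : x ∈ T
        · simp [hx, hf1 hx]
        · simp [hx]
    _ ≤ C * eLpNorm (fun x => (f x : ℂ)) p μ :=
        h _ (by fun_prop) (hfc.comp_left (g := fun r : ℝ => (r : ℂ)) Complex.ofReal_zero)
    _ ≤ C * eLpNorm (U.indicator fun _ => (1 : ℂ)) p μ := by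
        gcongr
        refine eLpNorm_mono fun x => ?_
        by_cases hx : x ∈ U
        · simpa [hx, abs_of_nonneg (hf01 x).1] using (hf01 x).2
        · simp [hf0 (show x ∈ Uᶜ from hx)]
    _ = _ := by rw [eLpNorm_indicator_const hU.measurableSet hp0 hp]; simp

variable [IsLocallyFiniteMeasure μ]

lemma exists_seq_hasCompactSupport_tendsto_ae (hp0 : p ≠ 0) (hp : p ≠ ∞) {H : α → ℂ}
    (hH : MemLp H p μ) :
    ∃ g : ℕ → α → ℂ, (∀ n, Continuous (g n)) ∧ (∀ n, HasCompactSupport (g n)) ∧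
      Tendsto (fun n => eLpNorm (g n - H) p μ) atTop (𝓝 0) ∧
      ∀ᵐ x ∂μ, Tendsto (fun n => g n x) atTop (𝓝 (H x)) := by
  have hε (n : ℕ) : (n : ℝ≥0∞)⁻¹ ≠ 0 := ENNReal.inv_ne_zero.2 (ENNReal.natCast_ne_top n)
  choose g hg_support hg_le hg_cont _ using fun n : ℕ =>
    hH.exists_hasCompactSupport_eLpNorm_sub_le hp (hε n)
  have hlim : Tendsto (fun n => eLpNorm (g n - H) p μ) atTop (𝓝 0) := by
    refine tendsto_of_tendsto_of_tendsto_of_le_of_le tendsto_const_nhds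
      ENNReal.tendsto_inv_nat_nhds_zero (fun n => zero_le) fun n => ?_
    rw [eLpNorm_sub_comm]
    exact hg_le n
  obtain ⟨ns, hns, hae⟩ := (tendstoInMeasure_of_tendsto_eLpNorm hp0
    (fun n => (hg_cont n).aestronglyMeasurable) hH.1 hlim).exists_seq_tendsto_ae
  exact ⟨fun n => g (ns n), fun n => hg_cont _, fun n => hg_support _,
    hlim.comp hns.tendsto_atTop, hae⟩

variable [IsFiniteMeasure m]

lemma absolutelyContinuous_of_lintegral_le (hp0 : p ≠ 0) (hp : p ≠ ∞) (hC : C ≠ ∞)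
    (h : ∀ g : α → ℂ, Continuous g → HasCompactSupport g →
      ∫⁻ x, ‖g x‖ₑ ∂m ≤ C * eLpNorm g p μ) : m ≪ μ := by
  refine Measure.AbsolutelyContinuous.mk fun s _ hs0 => ?_
  refine le_antisymm (_root_.le_of_forall_pos_le_add fun ε hε => ?_) zero_le
  rw [zero_add]
  have hexp : 0 < 1 / p.toReal := one_div_pos.2 (ENNReal.toReal_pos hp0 hp)
  have ht : Tendsto (fun r : ℝ≥0∞ => C * r ^ (1 / p.toReal)) (𝓝 0) (𝓝 0) := by
    have := ENNReal.Tendsto.const_mul (a := C)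
      (ENNReal.continuous_rpow_const (y := 1 / p.toReal).tendsto 0) (Or.inr hC)
    rwa [ENNReal.zero_rpow_of_pos hexp, mul_zero] at this
  obtain ⟨r, hr, hr0⟩ := (((ht.mono_left nhdsWithin_le_nhds).eventually_le_const hε).and
    (self_mem_nhdsWithin : Set.Ioi (0 : ℝ≥0∞) ∈ 𝓝[>] 0)).exists
  obtain ⟨U, hsU, hU, hUr⟩ := s.exists_isOpen_lt_of_lt r (μ := μ) (by rw [hs0]; exact hr0)
  calc m s ≤ m U := measure_mono hsU
    _ ≤ C * μ U ^ (1 / p.toReal) := measure_le_of_forall_hasCompactSupport hp0 hp h hU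
    _ ≤ C * r ^ (1 / p.toReal) := by gcongr
    _ ≤ ε := hr

theorem lintegral_le_of_forall_hasCompactSupport (hp1 : 1 ≤ p) (hp : p ≠ ∞) (hC : C ≠ ∞)
    (h : ∀ g : α → ℂ, Continuous g → HasCompactSupport g →
      ∫⁻ x, ‖g x‖ₑ ∂m ≤ C * eLpNorm g p μ) {H : α → ℂ} (hH : MemLp H p μ) :
    ∫⁻ x, ‖H x‖ₑ ∂m ≤ C * eLpNorm H p μ := by
  have hp0 : p ≠ 0 := (zero_lt_one.trans_le hp1).ne'
  obtain ⟨g, hgc, hgs, hlim, hae⟩ := exists_seq_hasCompactSupport_tendsto_ae hp0 hp hH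
  calc ∫⁻ x, ‖H x‖ₑ ∂m = ∫⁻ x, liminf (fun n => ‖g n x‖ₑ) atTop ∂m := by
        refine lintegral_congr_ae ?_
        filter_upwards [(absolutelyContinuous_of_lintegral_le hp0 hp hC h).ae_le hae] with x hx
        exact hx.enorm.liminf_eq.symm
    _ ≤ liminf (fun n => ∫⁻ x, ‖g n x‖ₑ ∂m) atTop :=
        lintegral_liminf_le fun n => (hgc _).enorm.measurable
    _ ≤ liminf (fun n => C * (eLpNorm H p μ + eLpNorm (g n - H) p μ)) atTop := by
        refine liminf_le_liminf (Eventually.of_forall fun n => ?_)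
        refine (h _ (hgc _) (hgs _)).trans ?_
        gcongr
        calc eLpNorm (g n) p μ = eLpNorm (H + (g n - H)) p μ := by rw [add_sub_cancel]
          _ ≤ _ := eLpNorm_add_le hH.1 ((hgc _).aestronglyMeasurable.sub hH.1) hp1
    _ = C * eLpNorm H p μ := by
        have hsum := hlim.const_add (eLpNorm H p μ)
        rw [add_zero] at hsum
        exact (ENNReal.Tendsto.const_mul hsum (Or.inr hC)).liminf_eq

end MeasureBound

section QuadraticBound

section Definition

variable {k : Type*} [NontriviallyNormedField k] [MeasurableSpace k] [BorelSpace k]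
  {V : Type*} [AddCommGroup V] [Module k V] [TopologicalSpace V] [MeasurableSpace V] [BorelSpace V]
  {μ : Measure k} {ν : Measure V} {q : QuadraticForm k V} {φ : V → ℂ}

/-- The functional `H ↦ ∫ |H(q(X)) φ(X)| dX` is bounded on `L²(k)`. -/
def IsQuadraticallyBounded (μ : Measure k) (ν : Measure V) (q : QuadraticForm k V) (φ : V → ℂ) :
    Prop :=
  ∃ C : ℝ≥0∞, C ≠ ∞ ∧ ∀ H : k → ℂ, Measurable H → MemLp H 2 μ →
    ∫⁻ X, ‖φ X‖ₑ * ‖H (q X)‖ₑ ∂ν ≤ C * eLpNorm H 2 μ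

lemma IsQuadraticallyBounded.ae_of_ae (hb : IsQuadraticallyBounded μ ν q φ)
    (hφc : Continuous φ) (hqc : Continuous q) {P : k → Prop} (hP : ∀ᵐ x ∂μ, P x) :
    ∀ᵐ X ∂ν, φ X ≠ 0 → P (q X) := by
  obtain ⟨C, -, h⟩ := hb
  obtain ⟨s, hs, hsm, hs0⟩ := exists_measurable_superset_of_null (ae_iff.1 hP)
  have hnull : eLpNorm (s.indicator fun _ => (1 : ℂ)) 2 μ = 0 :=
    (eLpNorm_eq_zero_iff (aestronglyMeasurable_const.indicator hsm) two_ne_zero).2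
      (indicator_meas_zero hs0)
  have hzero := h (s.indicator fun _ => 1) (measurable_const.indicator hsm)
    ⟨aestronglyMeasurable_const.indicator hsm, hnull ▸ zero_lt_top⟩
  have hmeas : Measurable fun X => ‖φ X‖ₑ * ‖s.indicator (fun _ => (1 : ℂ)) (q X)‖ₑ :=
    hφc.enorm.measurable.mul ((measurable_const.indicator hsm).enorm.comp hqc.measurable)
  rw [hnull, mul_zero, nonpos_iff_eq_zero, lintegral_eq_zero_iff hmeas] at hzero
  filter_upwards [hzero] with X hX hφX
  by_contra hPX
  have hXs : q X ∈ s := hs hPX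
  simp [hXs, hφX] at hX

lemma IsQuadraticallyBounded.mul_comp_ae_eq (hb : IsQuadraticallyBounded μ ν q φ)
    (hφc : Continuous φ) (hqc : Continuous q) {H H' : k → ℂ} (h : H =ᵐ[μ] H') :
    (fun X => φ X * H (q X)) =ᵐ[ν] fun X => φ X * H' (q X) := by
  filter_upwards [hb.ae_of_ae hφc hqc h] with X hX
  by_cases h0 : φ X = 0
  · simp [h0]
  · rw [hX h0]

lemma IsQuadraticallyBounded.exists_lintegral_le (hb : IsQuadraticallyBounded μ ν q φ)
    (hφc : Continuous φ) (hqc : Continuous q) :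
    ∃ C : ℝ≥0∞, C ≠ ∞ ∧ ∀ H : k → ℂ, MemLp H 2 μ →
      ∫⁻ X, ‖φ X * H (q X)‖ₑ ∂ν ≤ C * eLpNorm H 2 μ := by
  obtain ⟨C, hC, h⟩ := id hb
  refine ⟨C, hC, fun H hH => ?_⟩
  have hHm := hH.aestronglyMeasurable
  have hmk := hHm.ae_eq_mk
  calc ∫⁻ X, ‖φ X * H (q X)‖ₑ ∂ν = ∫⁻ X, ‖φ X * hHm.mk H (q X)‖ₑ ∂ν :=
        lintegral_congr_ae ((hb.mul_comp_ae_eq hφc hqc hmk).fun_comp (‖·‖ₑ))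
    _ ≤ C * eLpNorm (hHm.mk H) 2 μ := by
        simpa only [enorm_mul] using h _ hHm.stronglyMeasurable_mk.measurable (hH.ae_eq hmk)
    _ = C * eLpNorm H 2 μ := by rw [eLpNorm_congr_ae hmk]

lemma IsQuadraticallyBounded.integrable_mul_comp (hb : IsQuadraticallyBounded μ ν q φ)
    (hφc : Continuous φ) (hqc : Continuous q) {H : k → ℂ} (hH : MemLp H 2 μ) :
    Integrable (fun X => φ X * H (q X)) ν := by
  obtain ⟨C, hC, h⟩ := hb.exists_lintegral_le hφc hqc
  refine ⟨?_, (h H hH).trans_lt (ENNReal.mul_lt_top hC.lt_top hH.2)⟩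
  exact (hφc.measurable.mul (hH.1.stronglyMeasurable_mk.measurable.comp
    hqc.measurable)).aestronglyMeasurable.congr
      (hb.mul_comp_ae_eq hφc hqc hH.1.ae_eq_mk).symm

lemma IsQuadraticallyBounded.tendsto_integral_mul_comp (hb : IsQuadraticallyBounded μ ν q φ)
    (hφc : Continuous φ) (hqc : Continuous q) {G : k → ℂ} (hG2 : MemLp G 2 μ)
    {g : ℕ → k → ℂ} (hg2 : ∀ n, MemLp (g n) 2 μ)
    (hlim : Tendsto (fun n => eLpNorm (g n - G) 2 μ) atTop (𝓝 0)) :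
    Tendsto (fun n => ∫ X, φ X * g n (q X) ∂ν) atTop (𝓝 (∫ X, φ X * G (q X) ∂ν)) := by
  obtain ⟨C, hC, h⟩ := hb.exists_lintegral_le hφc hqc
  have hlimC := ENNReal.Tendsto.const_mul hlim (Or.inr hC)
  rw [mul_zero] at hlimC
  refine tendsto_integral_of_L1 _ (hb.integrable_mul_comp hφc hqc hG2).aestronglyMeasurable
    (Eventually.of_forall fun n => hb.integrable_mul_comp hφc hqc (hg2 n))
    (tendsto_of_tendsto_of_tendsto_of_le_of_le tendsto_const_nhds hlimC (fun n => zero_le)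
      fun n => ?_)
  simp_rw [← mul_sub]
  exact h _ ((hg2 n).sub hG2)

end Definition

lemma eLpNorm_two_eq {α : Type*} [MeasurableSpace α] (m : Measure α) (f : α → ℂ) :
    eLpNorm f 2 m = (∫⁻ x, ‖f x‖ₑ ^ 2 ∂m) ^ (1 / 2 : ℝ) := by
  rw [eLpNorm_eq_lintegral_rpow_enorm_toReal two_ne_zero ENNReal.ofNat_ne_top]
  simp

lemma lintegral_enorm_eq_enorm_integral {α : Type*} [MeasurableSpace α] {m : Measure α}
    {f : α → ℂ} (hf : Integrable f m) (h0 : ∀ x, ((‖f x‖ : ℝ) : ℂ) = f x) :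
    ∫⁻ x, ‖f x‖ₑ ∂m = ‖∫ x, f x ∂m‖ₑ := by
  have hint : ∫ x, f x ∂m = ((∫ x, ‖f x‖ ∂m : ℝ) : ℂ) := by
    rw [← integral_complex_ofReal]
    simp_rw [h0]
  rw [hint, ← ofReal_norm, Complex.norm_real,
    Real.norm_of_nonneg (integral_nonneg fun x => norm_nonneg _),
    ofReal_integral_norm_eq_lintegral_enorm hf]

variable {k : Type*} [NontriviallyNormedField k] [MeasurableSpace k] [BorelSpace k]
  {V : Type*} [AddCommGroup V] [Module k V] [FiniteDimensional k V]
  [TopologicalSpace V] [IsTopologicalAddGroup V] [ContinuousSMul k V] [T2Space V]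
  [MeasurableSpace V] [BorelSpace V]
  {ψ : AddChar k Circle} {μ : Measure k} {ν : Measure V} {q : QuadraticForm k V} {K : k → ℂ}
  {φ : V → ℂ} {G : k → ℂ}

lemma fourierField_sub (hψ : Continuous ψ) (hG : Integrable G μ) {g : k → ℂ}
    (hg : Integrable g μ) (t : k) :
    fourierField ψ μ (G - g) t = fourierField ψ μ G t - fourierField ψ μ g t := by
  simp only [fourierField_apply, Pi.sub_apply, sub_mul]
  exact integral_sub (integrable_mul_char hψ hG (by fun_prop))
    (integrable_mul_char hψ hg (by fun_prop))

variable [LocallyCompactSpace k] [μ.IsAddHaarMeasure] [NeZero (2 : k)]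

lemma exists_lintegral_fourier_mul_le (hψ : Continuous ψ) (hK : IsSummationKernel ψ μ K)
    (hV : 2 ≤ Module.finrank k V) (hν : IsSelfDual ψ (QuadraticMap.polarBilin q) ν)
    (hφ : HasIntegrableFourier ψ (QuadraticMap.polarBilin q) ν φ) :
    ∃ C : ℝ≥0∞, C ≠ ∞ ∧ ∀ G : k → ℂ, Integrable G μ →
      ∫⁻ t, ‖fourierField ψ μ G t * fourierQuad ψ q ν φ (-t)‖ₑ ∂μ ≤ C * eLpNorm G 2 μ := by
  have hF := lintegral_fourierQuad_sq_lt_top hψ q hV μ hν hφ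
  have hFc := continuous_fourierQuad hψ q hφ.integrable
  refine ⟨(∫⁻ z, ‖fourierField ψ μ K z‖ₑ ∂μ) ^ (1 / 2 : ℝ) *
    (∫⁻ t, ‖fourierQuad ψ q ν φ t‖ₑ ^ 2 ∂μ) ^ (1 / 2 : ℝ), ?_, fun G hG => ?_⟩
  · exact ENNReal.mul_ne_top
      (ENNReal.rpow_ne_top_of_nonneg (by norm_num) hK.integrable_fourier.2.ne)
      (ENNReal.rpow_ne_top_of_nonneg (by norm_num) hF.ne)
  simp_rw [enorm_mul]
  calc ∫⁻ t, ‖fourierField ψ μ G t‖ₑ * ‖fourierQuad ψ q ν φ (-t)‖ₑ ∂μ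
      ≤ (∫⁻ t, ‖fourierField ψ μ G t‖ₑ ^ (2 : ℝ) ∂μ) ^ (1 / 2 : ℝ) *
        (∫⁻ t, ‖fourierQuad ψ q ν φ (-t)‖ₑ ^ (2 : ℝ) ∂μ) ^ (1 / 2 : ℝ) :=
        ENNReal.lintegral_mul_le_Lp_mul_Lq μ Real.HolderConjugate.two_two
          (continuous_fourierField hψ hG).enorm.measurable.aemeasurable
          (hFc.comp continuous_neg).enorm.measurable.aemeasurable
    _ ≤ ((∫⁻ z, ‖fourierField ψ μ K z‖ₑ ∂μ) * ∫⁻ x, ‖G x‖ₑ ^ 2 ∂μ) ^ (1 / 2 : ℝ) *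
        (∫⁻ t, ‖fourierQuad ψ q ν φ t‖ₑ ^ 2 ∂μ) ^ (1 / 2 : ℝ) := by
        simp_rw [ENNReal.rpow_two]
        rw [lintegral_neg_eq_self (fun t => ‖fourierQuad ψ q ν φ t‖ₑ ^ 2)]
        gcongr
        exact lintegral_fourierField_sq_le hψ hK hG
    _ = _ := by
        rw [ENNReal.mul_rpow_of_nonneg _ _ (by norm_num), eLpNorm_two_eq]
        ring

lemma integrable_fourierField_mul_fourierQuad (hψ : Continuous ψ)
    (hK : IsSummationKernel ψ μ K)
    (hV : 2 ≤ Module.finrank k V) (hν : IsSelfDual ψ (QuadraticMap.polarBilin q) ν)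
    (hφ : HasIntegrableFourier ψ (QuadraticMap.polarBilin q) ν φ)
    (hG : Integrable G μ) (hG2 : MemLp G 2 μ) :
    Integrable (fun t => fourierField ψ μ G t * fourierQuad ψ q ν φ (-t)) μ := by
  obtain ⟨C, hC, h⟩ := exists_lintegral_fourier_mul_le hψ hK hV hν hφ
  exact ⟨((continuous_fourierField hψ hG).mul
    ((continuous_fourierQuad hψ q hφ.integrable).comp continuous_neg)).aestronglyMeasurable,
    (h G hG).trans_lt (ENNReal.mul_lt_top hC.lt_top hG2.2)⟩

lemma integral_fourierField_mul_fourierQuad_of_hasCompactSupport (hψ : Continuous ψ)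
    (hSD : IsSelfDual ψ (LinearMap.mul k k) μ) (hK : IsSummationKernel ψ μ K)
    (hV : 2 ≤ Module.finrank k V) (hν : IsSelfDual ψ (QuadraticMap.polarBilin q) ν)
    (hφ : HasIntegrableFourier ψ (QuadraticMap.polarBilin q) ν φ)
    {g : k → ℂ} (hgc : Continuous g) (hgs : HasCompactSupport g) :
    ∫ t, fourierField ψ μ g t * fourierQuad ψ q ν φ (-t) ∂μ = ∫ X, φ X * g (q X) ∂ν := by
  have : SecondCountableTopology V := secondCountable_of_finiteDimensional k V
  have : LocallyCompactSpace V := LocallyCompactSpace.of_finiteDimensional_of_complete k V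
  have := hν.1
  obtain ⟨D, hD⟩ := hgs.exists_bound_of_continuous hgc
  have hgi : Integrable g μ := hgc.integrable_of_hasCompactSupport hgs
  exact integral_fourierField_mul_integral hψ hSD hK hgc hgi hD hφ.integrable
    (continuous_quadraticForm q).measurable
    (integrable_fourierField_mul_fourierQuad hψ hK hV hν hφ hgi
      (hgc.memLp_of_hasCompactSupport hgs))

lemma exists_lintegral_mul_comp_le_of_hasCompactSupport (hψ : Continuous ψ)
    (hSD : IsSelfDual ψ (LinearMap.mul k k) μ) (hK : IsSummationKernel ψ μ K)
    (hV : 2 ≤ Module.finrank k V) (hν : IsSelfDual ψ (QuadraticMap.polarBilin q) ν)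
    (hφ : HasIntegrableFourier ψ (QuadraticMap.polarBilin q) ν φ)
    (hφ0 : ∀ X, ((‖φ X‖ : ℝ) : ℂ) = φ X) :
    ∃ C : ℝ≥0∞, C ≠ ∞ ∧ ∀ g : k → ℂ, Continuous g → HasCompactSupport g →
      ∫⁻ X, ‖φ X‖ₑ * ‖g (q X)‖ₑ ∂ν ≤ C * eLpNorm g 2 μ := by
  obtain ⟨C, hC, h⟩ := exists_lintegral_fourier_mul_le hψ hK hV hν hφ
  refine ⟨C, hC, fun g hgc hgs => ?_⟩
  have hqc := continuous_quadraticForm q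
  have : SecondCountableTopology V := secondCountable_of_finiteDimensional k V
  obtain ⟨D, hD⟩ := hgs.exists_bound_of_continuous hgc
  let g' : k → ℂ := fun x => ((‖g x‖ : ℝ) : ℂ)
  have hg'c : Continuous g' := by fun_prop
  have hg's : HasCompactSupport g' :=
    hgs.comp_left (g := fun z : ℂ => ((‖z‖ : ℝ) : ℂ)) (by simp)
  have hint : Integrable (fun X => φ X * g' (q X)) ν :=
    hφ.integrable.mul_bdd (c := D) (Continuous.aestronglyMeasurable (by fun_prop))
      (Eventually.of_forall fun X => by simpa [g'] using hD (q X))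
  calc ∫⁻ X, ‖φ X‖ₑ * ‖g (q X)‖ₑ ∂ν = ∫⁻ X, ‖φ X * g' (q X)‖ₑ ∂ν := by
        simp [g', ← ofReal_norm]
    _ = ‖∫ X, φ X * g' (q X) ∂ν‖ₑ := by
        refine lintegral_enorm_eq_enorm_integral hint fun X => ?_
        simp [g', hφ0]
    _ = ‖∫ t, fourierField ψ μ g' t * fourierQuad ψ q ν φ (-t) ∂μ‖ₑ := by
        rw [integral_fourierField_mul_fourierQuad_of_hasCompactSupport hψ hSD hK hV hν hφ hg'c hg's]
    _ ≤ C * eLpNorm g' 2 μ := (enorm_integral_le_lintegral_enorm _).trans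
        (h _ (hg'c.integrable_of_hasCompactSupport hg's))
    _ = C * eLpNorm g 2 μ := by
        rw [eLpNorm_congr_norm_ae (g := g) (Eventually.of_forall fun x => by simp [g'])]

theorem isQuadraticallyBounded_of_nonneg (hψ : Continuous ψ)
    (hSD : IsSelfDual ψ (LinearMap.mul k k) μ) (hK : IsSummationKernel ψ μ K)
    (hV : 2 ≤ Module.finrank k V) (hν : IsSelfDual ψ (QuadraticMap.polarBilin q) ν)
    (hφ : HasIntegrableFourier ψ (QuadraticMap.polarBilin q) ν φ)
    (hφ0 : ∀ X, ((‖φ X‖ : ℝ) : ℂ) = φ X) : IsQuadraticallyBounded μ ν q φ := by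
  have hqc := continuous_quadraticForm q
  obtain ⟨C, hC, h⟩ :=
    exists_lintegral_mul_comp_le_of_hasCompactSupport hψ hSD hK hV hν hφ hφ0
  let m : Measure k := (ν.withDensity fun X => ‖φ X‖ₑ).map q
  have hfin : IsFiniteMeasure (ν.withDensity fun X => ‖φ X‖ₑ) :=
    isFiniteMeasure_withDensity hφ.integrable.2.ne
  have : IsFiniteMeasure m := Measure.isFiniteMeasure_map _ _
  have hm (H : k → ℂ) (hH : Measurable H) :
      ∫⁻ x, ‖H x‖ₑ ∂m = ∫⁻ X, ‖φ X‖ₑ * ‖H (q X)‖ₑ ∂ν := by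
    rw [lintegral_map hH.enorm hqc.measurable]
    exact lintegral_withDensity_eq_lintegral_mul ν hφ.continuous.enorm.measurable
      (hH.comp hqc.measurable).enorm
  refine ⟨C, hC, fun H hHm hH => ?_⟩
  rw [← hm H hHm]
  refine lintegral_le_of_forall_hasCompactSupport one_le_two ENNReal.ofNat_ne_top hC
    (fun g hgc hgs => ?_) hH
  rw [hm g hgc.measurable]
  exact h g hgc hgs

lemma tendsto_integral_fourierField_mul_fourierQuad (hψ : Continuous ψ)
    (hK : IsSummationKernel ψ μ K)
    (hV : 2 ≤ Module.finrank k V) (hν : IsSelfDual ψ (QuadraticMap.polarBilin q) ν)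
    (hφ : HasIntegrableFourier ψ (QuadraticMap.polarBilin q) ν φ)
    (hG : Integrable G μ) (hG2 : MemLp G 2 μ) {g : ℕ → k → ℂ}
    (hg : ∀ n, Integrable (g n) μ) (hg2 : ∀ n, MemLp (g n) 2 μ)
    (hlim : Tendsto (fun n => eLpNorm (g n - G) 2 μ) atTop (𝓝 0)) :
    Tendsto (fun n => ∫ t, fourierField ψ μ (g n) t * fourierQuad ψ q ν φ (-t) ∂μ) atTop
      (𝓝 (∫ t, fourierField ψ μ G t * fourierQuad ψ q ν φ (-t) ∂μ)) := by
  obtain ⟨C, hC, h⟩ := exists_lintegral_fourier_mul_le hψ hK hV hν hφ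
  have hlimC := ENNReal.Tendsto.const_mul hlim (Or.inr hC)
  rw [mul_zero] at hlimC
  refine tendsto_integral_of_L1 _
    (integrable_fourierField_mul_fourierQuad hψ hK hV hν hφ hG hG2).aestronglyMeasurable
    (Eventually.of_forall fun n =>
      integrable_fourierField_mul_fourierQuad hψ hK hV hν hφ (hg n) (hg2 n))
    (tendsto_of_tendsto_of_tendsto_of_le_of_le tendsto_const_nhds hlimC (fun n => zero_le)
      fun n => ?_)
  simp_rw [← sub_mul, ← fourierField_sub hψ (hg n) hG]
  exact h _ ((hg n).sub hG)

theorem integral_fourierField_mul_fourierQuad (hψ : Continuous ψ)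
    (hSD : IsSelfDual ψ (LinearMap.mul k k) μ) (hK : IsSummationKernel ψ μ K)
    (hV : 2 ≤ Module.finrank k V) (hν : IsSelfDual ψ (QuadraticMap.polarBilin q) ν)
    (hφ : HasIntegrableFourier ψ (QuadraticMap.polarBilin q) ν φ)
    (hb : IsQuadraticallyBounded μ ν q φ) (hG : Integrable G μ) (hG2 : MemLp G 2 μ) :
    ∫ t, fourierField ψ μ G t * fourierQuad ψ q ν φ (-t) ∂μ = ∫ X, φ X * G (q X) ∂ν := by
  obtain ⟨g, hgc, hgs, hlim, -⟩ :=
    exists_seq_hasCompactSupport_tendsto_ae two_ne_zero ENNReal.ofNat_ne_top hG2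
  have hg2 (n : ℕ) : MemLp (g n) 2 μ := (hgc n).memLp_of_hasCompactSupport (hgs n)
  refine tendsto_nhds_unique (tendsto_integral_fourierField_mul_fourierQuad hψ hK hV hν hφ hG hG2
    (fun n => (hgc n).integrable_of_hasCompactSupport (hgs n)) hg2 hlim) ?_
  simp_rw [fun n => integral_fourierField_mul_fourierQuad_of_hasCompactSupport hψ hSD hK hV hν hφ
    (hgc n) (hgs n)]
  exact hb.tendsto_integral_mul_comp hφ.continuous (continuous_quadraticForm q) hG2 hg2 hlim

end QuadraticBound

section LocallyConstant

lemma exists_pos_forall_norm_lt_add_eq {E α : Type*} [NormedAddCommGroup E] [Zero α] {f : E → α}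
    (hf : IsLocallyConstant f) (hc : HasCompactSupport f) :
    ∃ r > 0, ∀ x z : E, ‖z‖ < r → f (x + z) = f x := by
  obtain ⟨r, hr, h⟩ := lebesgue_number_lemma_of_metric (s := tsupport f)
    (c := fun a : α => f ⁻¹' {a}) hc (fun a => hf {a}) (fun x _ => by simp)
  have heq {x y : E} (hx : x ∈ tsupport f) (hxy : dist y x < r) : f y = f x := by
    obtain ⟨a, ha⟩ := h x hx
    exact (show f y = a from ha hxy).trans (show f x = a from ha (Metric.mem_ball_self hr)).symm
  refine ⟨r, hr, fun x z hz => ?_⟩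
  by_cases hx : x ∈ tsupport f
  · exact heq hx (by simpa using hz)
  by_cases hxz : x + z ∈ tsupport f
  · exact (heq hxz (by simpa [dist_eq_norm] using hz)).symm
  · rw [image_eq_zero_of_notMem_tsupport hx, image_eq_zero_of_notMem_tsupport hxz]

lemma norm_le_of_forall_char_mul_eq_one {k : Type*} [NormedField k] {ψ : AddChar k Circle}
    {a x : k} {r : ℝ} (ha : ψ a ≠ 1) (hr : 0 < r) (h : ∀ c, ‖c‖ < r → ψ (c * x) = 1) :
    ‖x‖ ≤ ‖a‖ / r := by
  rcases eq_or_ne x 0 with rfl | hx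
  · rw [norm_zero]
    positivity
  by_contra! hlt
  refine ha ?_
  rw [← div_mul_cancel₀ a hx]
  refine h _ ?_
  rwa [norm_div, div_lt_comm₀ (norm_pos_iff.2 hx) hr]

section Period

variable {k V : Type*} [Field k] [AddCommGroup V] [Module k V] [TopologicalSpace V]
  [IsTopologicalAddGroup V] [MeasurableSpace V] [BorelSpace V] {ν : Measure V}
  [ν.IsAddHaarMeasure] {ψ : AddChar k Circle}

lemma char_bilin_eq_one_of_bilinFourier_ne_zero {B : LinearMap.BilinForm k V} {φ : V → ℂ}
    {Y Z : V} (hZ : ∀ X, φ (X + Z) = φ X) (hY : bilinFourier ψ B ν φ Y ≠ 0) :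
    ψ (B Z Y) = 1 := by
  have htranslate : bilinFourier ψ B ν φ Y = bilinFourier ψ B ν φ Y * (ψ (B Z Y) : ℂ) := by
    conv_lhs => rw [bilinFourier, ← integral_add_right_eq_self _ Z]
    rw [bilinFourier, ← integral_mul_const]
    simp only [hZ, map_add, LinearMap.add_apply, AddChar.map_add_eq_mul, Circle.coe_mul, mul_assoc]
  exact Circle.ext (mul_eq_left₀ hY |>.1 htranslate.symm)

end Period

variable {k : Type*} [NontriviallyNormedField k] [LocallyCompactSpace k]
  {V : Type*} [AddCommGroup V] [Module k V] [FiniteDimensional k V]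
  [TopologicalSpace V] [IsTopologicalAddGroup V] [ContinuousSMul k V] [T2Space V]
  {B : LinearMap.BilinForm k V}

lemma isCompact_setOf_forall_norm_bilin_le (hB : B.SeparatingRight) {ι : Type*}
    (b : Module.Basis ι k V) (R : ℝ) : IsCompact {Y | ∀ i, ‖B (b i) Y‖ ≤ R} := by
  let T : V →ₗ[k] (ι → k) := LinearMap.pi fun i => B (b i)
  have hT : LinearMap.ker T = ⊥ := LinearMap.ker_eq_bot'.2 fun Y hY => hB Y fun X =>
    LinearMap.congr_fun (b.ext fun i => congrFun hY i : B.flip Y = 0) X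
  have hpi : IsCompact (Set.univ.pi fun _ : ι => Metric.closedBall (0 : k) R) :=
    isCompact_univ_pi fun _ => isCompact_closedBall _ _
  convert (LinearMap.isClosedEmbedding_of_injective hT).isCompact_preimage hpi using 1
  ext Y
  simp [T]

variable [MeasurableSpace V] [BorelSpace V]
  {ψ : AddChar k Circle} {ν : Measure V} [ν.IsAddHaarMeasure] {φ : V → ℂ}

lemma hasCompactSupport_bilinFourier_of_isLocallyConstant (hψ1 : ψ ≠ 1)
    (hB : B.SeparatingRight) (hφ : IsLocallyConstant φ) (hφc : HasCompactSupport φ) :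
    HasCompactSupport (bilinFourier ψ B ν φ) := by
  let e := coords k V
  let b := (Pi.basisFun k (Fin (Module.finrank k V))).map e.symm.toLinearEquiv
  have heb (i : Fin (Module.finrank k V)) : e (b i) = Pi.single i 1 := by simp [b]
  obtain ⟨r, hr, hconst⟩ := exists_pos_forall_norm_lt_add_eq
    (f := fun x => φ (e.symm x)) (hφ.comp_continuous e.symm.continuous)
    (hφc.comp_homeomorph e.symm.toHomeomorph)
  have hperiod (Z : V) (hZ : ‖e Z‖ < r) (X : V) : φ (X + Z) = φ X := by
    simpa using hconst (e X) (e Z) hZ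
  obtain ⟨a, ha⟩ := AddChar.ne_one_iff.1 hψ1
  refine HasCompactSupport.of_support_subset_isCompact
    (isCompact_setOf_forall_norm_bilin_le hB b (‖a‖ / r)) fun Y hY i => ?_
  refine norm_le_of_forall_char_mul_eq_one ha hr fun c hc => ?_
  have hcb : ‖e (c • b i)‖ < r := by
    rwa [map_smul, heb, norm_smul, Pi.norm_single, norm_one, mul_one]
  simpa using char_bilin_eq_one_of_bilinFourier_ne_zero (hperiod _ hcb) hY

theorem HasIntegrableFourier.of_isLocallyConstant [MeasurableSpace k] [BorelSpace k]
    (hψ : Continuous ψ) (hψ1 : ψ ≠ 1) (hB : B.SeparatingRight) (hφ : IsLocallyConstant φ)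
    (hφc : HasCompactSupport φ) : HasIntegrableFourier ψ B ν φ := by
  have hφi : Integrable φ ν := hφ.continuous.integrable_of_hasCompactSupport hφc
  exact ⟨hφ.continuous, hφi, (continuous_bilinFourier hψ B hφi).integrable_of_hasCompactSupport
    (hasCompactSupport_bilinFourier_of_isLocallyConstant hψ1 hB hφ hφc)⟩

end LocallyConstant

section Archimedean

theorem exists_fourierChar_eq {E : Type*} [NormedAddCommGroup E] [NormedSpace ℝ E]
    (χ : AddChar E Circle) (hχ : Continuous χ) :
    ∃ L : E →L[ℝ] ℝ, ∀ x, χ x = Real.fourierChar (L x) := by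
  have cov : IsCoveringMap ((↑) : ℝ → AddCircle (2 * Real.pi)) := AddCircle.isCoveringMap_coe _
  let f : C(E, AddCircle (2 * Real.pi)) :=
    ⟨fun x => AddCircle.homeomorphCircle'.symm (χ x),
      AddCircle.homeomorphCircle'.symm.continuous.comp hχ⟩
  have hexp (r : ℝ) (x : E) : (r : AddCircle (2 * Real.pi)) = f x ↔ Circle.exp r = χ x := by
    rw [← AddCircle.homeomorphCircle'_apply_mk]
    exact (Equiv.eq_symm_apply _)
  obtain ⟨F, ⟨_, hF⟩, huniq⟩ := cov.existsUnique_continuousMap_lifts f 0 0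
    ((hexp 0 0).2 (by simp))
  have hFχ (x : E) : Circle.exp (F x) = χ x := (hexp _ _).1 (congrFun hF x)
  have hadd (x y : E) : F (x + y) = F x + F y := by
    -- `z ↦ F (z + y) - F y` also lifts `χ`, so it is `F` by uniqueness of lifts.
    have h := huniq ⟨fun z => F (z + y) - F y, by fun_prop⟩ ⟨by simp, funext fun z => ?_⟩
    · exact sub_eq_iff_eq_add.1 (DFunLike.congr_fun h x)
    · refine (hexp _ _).2 ?_
      simp only [ContinuousMap.coe_mk]
      rw [Circle.exp_sub, hFχ, hFχ, AddChar.map_add_eq_mul, mul_div_cancel_right]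
  let L : E →L[ℝ] ℝ := (AddMonoidHom.mk' F hadd).toRealLinearMap F.continuous
  refine ⟨(2 * Real.pi)⁻¹ • L, fun x => ?_⟩
  change χ x = Circle.exp (2 * Real.pi * ((2 * Real.pi)⁻¹ * F x))
  rw [mul_inv_cancel_left₀ (by positivity), hFχ]

lemma exists_inner_eq_of_biadditive {E : Type*} [NormedAddCommGroup E] [InnerProductSpace ℝ E]
    [FiniteDimensional ℝ E] {β : E → E → ℝ} (hβ : Continuous (Function.uncurry β))
    (hadd_left : ∀ x x' y, β (x + x') y = β x y + β x' y)
    (hadd_right : ∀ x y y', β x (y + y') = β x y + β x y') :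
    ∃ T : E →L[ℝ] E, ∀ x y, inner ℝ x (T y) = β x y := by
  let L (y : E) : E →L[ℝ] ℝ :=
    (AddMonoidHom.mk' (β · y) (hadd_left · · y)).toRealLinearMap hβ.along_fst
  let R (x : E) : E →L[ℝ] ℝ :=
    (AddMonoidHom.mk' (β x) (hadd_right x)).toRealLinearMap hβ.along_snd
  let T (y : E) : E := (InnerProductSpace.toDual ℝ E).symm (L y)
  have hT (x y : E) : inner ℝ x (T y) = R x y := by
    rw [real_inner_comm, InnerProductSpace.toDual_symm_apply]
    rfl
  let T' : E →ₗ[ℝ] E :=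
    { toFun := T
      map_add' := fun y y' => ext_inner_left ℝ fun x => by simp only [inner_add_right, hT, map_add]
      map_smul' := fun c y => ext_inner_left ℝ fun x => by
        simp only [inner_smul_right, hT, map_smul, RingHom.id_apply, smul_eq_mul] }
  exact ⟨T'.toContinuousLinearMap, hT⟩

lemma eq_zero_of_forall_char_bilin_eq_one {k V : Type*} [Field k] [AddCommGroup V] [Module k V]
    {ψ : AddChar k Circle} (hψ1 : ψ ≠ 1) {B : LinearMap.BilinForm k V} (hB : B.SeparatingRight)
    {Y : V} (h : ∀ X, ψ (B X Y) = 1) : Y = 0 := by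
  obtain ⟨a, ha⟩ := AddChar.ne_one_iff.1 hψ1
  refine hB Y fun X => by_contra fun h0 => ha ?_
  simpa [h0] using h ((a / B X Y) • X)

lemma charZero_of_isAddTorsionFree (k V : Type*) [Ring k] [AddCommGroup V] [Module k V]
    [Nontrivial V] [IsAddTorsionFree V] : CharZero k := by
  obtain ⟨v, hv⟩ := exists_ne (0 : V)
  refine charZero_of_inj_zero fun n hn => ?_
  have hnv : n • v = 0 := by rw [← Nat.cast_smul_eq_nsmul k, hn, zero_smul]
  exact (smul_eq_zero.1 hnv).resolve_right hv

section Subspace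

variable {E : Type*} [NormedAddCommGroup E] [NormedSpace ℝ E]

/-- The range of an additive map out of a rational vector space, as a real subspace; it is one
because a closed `ℚ`-subspace of a real normed space is stable under real scalars. -/
noncomputable def closedRange {A : Type*} [AddCommGroup A] [Module ℚ A] (f : A →+ E)
    (hf : IsClosed (Set.range f)) : Submodule ℝ E where
  __ := f.range
  smul_mem' := by
    rintro c _ ⟨a, rfl⟩
    have hcl : IsClosed {c : ℝ | c • f a ∈ Set.range f} := hf.preimage (by fun_prop)
    refine isClosed_property Rat.denseRange_cast hcl (fun r => ⟨r • a, ?_⟩) c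
    let _ : Module ℚ E := Module.compHom E (algebraMap ℚ ℝ)
    rw [map_rat_smul, Rat.cast_smul_eq_qsmul]

theorem exists_continuousAddEquiv_euclidean_of_isClosedEmbedding [FiniteDimensional ℝ E]
    {A : Type*} [AddCommGroup A] [Module ℚ A] [TopologicalSpace A] {f : A →+ E}
    (hf : IsClosedEmbedding f) : ∃ d : ℕ, Nonempty (A ≃ₜ+ EuclideanSpace ℝ (Fin d)) := by
  let S := closedRange f hf.isClosed_range
  let g₀ : A ≃ₜ S := hf.toIsEmbedding.toHomeomorph
  let g : A ≃ₜ+ S := { g₀ with map_add' := fun a b => Subtype.ext (map_add f a b) }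
  exact ⟨_, ⟨g.trans (toEuclidean (E := S)).toContinuousAddEquiv⟩⟩

end Subspace

lemma integrable_comp_continuousAddEquiv {V : Type*} [AddCommGroup V]
    [TopologicalSpace V] [IsTopologicalAddGroup V] [MeasurableSpace V] [BorelSpace V]
    {ν : Measure V} [ν.IsAddHaarMeasure] {N : ℕ} (e : V ≃ₜ+ EuclideanSpace ℝ (Fin N))
    (f : SchwartzMap (EuclideanSpace ℝ (Fin N)) ℂ) : Integrable (fun X => f (e X)) ν := by
  have : (ν.map e).IsAddHaarMeasure := e.isAddHaarMeasure_map ν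
  have hf : Integrable f (ν.map e) := f.integrable
  exact e.toHomeomorph.measurableEmbedding.integrable_map_iff.1 hf

lemma exists_bilinFourier_comp_eq {k V : Type*} [NontriviallyNormedField k] [AddCommGroup V]
    [Module k V] [TopologicalSpace V] [IsTopologicalAddGroup V] [MeasurableSpace V] [BorelSpace V]
    {ψ : AddChar k Circle} {B : LinearMap.BilinForm k V} {ν : Measure V} [ν.IsAddHaarMeasure]
    {N : ℕ} (e : V ≃ₜ+ EuclideanSpace ℝ (Fin N))
    {T : EuclideanSpace ℝ (Fin N) → EuclideanSpace ℝ (Fin N)}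
    (hT : ∀ X Y, ψ (B X Y) = Real.fourierChar (inner ℝ (e X) (T (e Y)))) :
    ∃ c : ℂ, ∀ (f : EuclideanSpace ℝ (Fin N) → ℂ) (Y : V),
      bilinFourier ψ B ν (fun X => f (e X)) Y = c * FourierTransform.fourier f (-T (e Y)) := by
  have hHaar : (ν.map e).IsAddHaarMeasure := e.isAddHaarMeasure_map ν
  refine ⟨(ν.map e).addHaarScalarFactor volume, fun f Y => ?_⟩
  let F (x : EuclideanSpace ℝ (Fin N)) : ℂ := f x * (Real.fourierChar (inner ℝ x (T (e Y))) : ℂ)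
  calc bilinFourier ψ B ν (fun X => f (e X)) Y = ∫ X, F (e X) ∂ν := by
        simp only [bilinFourier, F, hT]
    _ = ∫ x, F x ∂(ν.map e) := (e.toHomeomorph.measurableEmbedding.integral_map F).symm
    _ = (ν.map e).addHaarScalarFactor volume * ∫ x, F x := by
        conv_lhs => rw [Measure.isAddLeftInvariant_eq_smul (ν.map e) volume]
        rw [integral_smul_nnreal_measure]
        rfl
    _ = _ := by
        simp only [F, Real.fourier_eq, inner_neg_right, neg_neg, Circle.smul_def, smul_eq_mul,
          mul_comm]

variable {k : Type*} [NontriviallyNormedField k] [LocallyCompactSpace k]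
  {V : Type*} [AddCommGroup V] [Module k V]
  [TopologicalSpace V] [IsTopologicalAddGroup V] [ContinuousSMul k V] [T2Space V]

theorem exists_continuousAddEquiv_euclidean [Nontrivial V] {N : ℕ}
    (e : V ≃ₜ+ EuclideanSpace ℝ (Fin N)) :
    ∃ d : ℕ, Nonempty (k ≃ₜ+ EuclideanSpace ℝ (Fin d)) := by
  have : IsAddTorsionFree (EuclideanSpace ℝ (Fin N)) := .of_isTorsionFree ℝ _
  have : IsAddTorsionFree V := e.injective.isAddTorsionFree e.toAddMonoidHom
  have := charZero_of_isAddTorsionFree k V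
  obtain ⟨v, hv⟩ := exists_ne (0 : V)
  let f : k →+ EuclideanSpace ℝ (Fin N) :=
    e.toAddEquiv.toAddMonoidHom.comp ((smulAddHom k V).flip v)
  have hf : IsClosedEmbedding f :=
    e.toHomeomorph.isClosedEmbedding.comp (isClosedEmbedding_smul_left hv)
  exact exists_continuousAddEquiv_euclidean_of_isClosedEmbedding hf

variable [FiniteDimensional k V] {ψ : AddChar k Circle} {B : LinearMap.BilinForm k V}
  {N : ℕ} (e : V ≃ₜ+ EuclideanSpace ℝ (Fin N))

lemma exists_char_bilin_eq_fourierChar_inner (hψ : Continuous ψ) (B : LinearMap.BilinForm k V)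
    {d : ℕ} (g : k ≃ₜ+ EuclideanSpace ℝ (Fin d)) :
    ∃ T : EuclideanSpace ℝ (Fin N) →L[ℝ] EuclideanSpace ℝ (Fin N),
      ∀ X Y, ψ (B X Y) = Real.fourierChar (inner ℝ (e X) (T (e Y))) := by
  obtain ⟨L, hL⟩ := exists_fourierChar_eq (ψ.compAddMonoidHom g.symm.toAddEquiv.toAddMonoidHom)
    (hψ.comp g.symm.continuous)
  have hψL (a : k) : ψ a = Real.fourierChar (L (g a)) := by
    rw [← hL]
    exact congrArg ψ (g.symm_apply_apply a).symm
  have hβ : Continuous fun p : EuclideanSpace ℝ (Fin N) × EuclideanSpace ℝ (Fin N) =>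
      L (g (B (e.symm p.1) (e.symm p.2))) :=
    L.continuous.comp (g.continuous.comp ((continuous_bilin B).comp
      (e.symm.continuous.prodMap e.symm.continuous)))
  obtain ⟨T, hT⟩ := exists_inner_eq_of_biadditive
    (β := fun x y => L (g (B (e.symm x) (e.symm y)))) hβ (by simp) (by simp)
  exact ⟨T, fun X Y => by rw [hT, hψL, e.symm_apply_apply, e.symm_apply_apply]⟩

variable [MeasurableSpace V] [BorelSpace V] {ν : Measure V} [ν.IsAddHaarMeasure]

theorem HasIntegrableFourier.of_schwartz (hψ : Continuous ψ) (hψ1 : ψ ≠ 1)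
    (hB : B.SeparatingRight) {d : ℕ} (g : k ≃ₜ+ EuclideanSpace ℝ (Fin d))
    (f : SchwartzMap (EuclideanSpace ℝ (Fin N)) ℂ) :
    HasIntegrableFourier ψ B ν fun X => f (e X) := by
  obtain ⟨T, hT⟩ := exists_char_bilin_eq_fourierChar_inner e hψ B g
  have hTinj : Function.Injective (-T) := by
    rw [injective_iff_map_eq_zero]
    intro y hy
    rw [neg_apply, neg_eq_zero] at hy
    have hY : e.symm y = 0 := eq_zero_of_forall_char_bilin_eq_one hψ1 hB fun X => by
      rw [hT, e.apply_symm_apply, hy, inner_zero_right, AddChar.map_zero_eq_one]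
    simpa using congrArg e hY
  let T' : EuclideanSpace ℝ (Fin N) ≃L[ℝ] EuclideanSpace ℝ (Fin N) :=
    ((-T : _ →L[ℝ] _).toLinearMap.linearEquivOfInjective hTinj rfl).toContinuousLinearEquiv
  let f' : SchwartzMap (EuclideanSpace ℝ (Fin N)) ℂ :=
    SchwartzMap.compCLMOfContinuousLinearEquiv ℂ T' (FourierTransform.fourier f)
  obtain ⟨c, hc⟩ := exists_bilinFourier_comp_eq e (ν := ν) hT
  refine ⟨f.continuous.comp e.continuous, integrable_comp_continuousAddEquiv e f, ?_⟩
  have hbilin : (bilinFourier ψ B ν fun X => f (e X)) = fun Y => c * f' (e Y) :=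
    funext fun Y => (hc f Y).trans (by rw [← SchwartzMap.fourier_coe]; rfl)
  rw [hbilin]
  exact (integrable_comp_continuousAddEquiv e f').const_mul c

end Archimedean

section Kernel

lemma exists_schwartz_bump (N : ℕ) : ∃ f : SchwartzMap (EuclideanSpace ℝ (Fin N)) ℂ,
    (∀ x, ‖f x‖ ≤ 1) ∧ (∀ x, ((‖f x‖ : ℝ) : ℂ) = f x) ∧ ∀ x, ‖x‖ ≤ 1 → f x = 1 := by
  let b : ContDiffBump (0 : EuclideanSpace ℝ (Fin N)) := ⟨1, 2, one_pos, one_lt_two⟩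
  have hc : HasCompactSupport fun x => (b x : ℂ) :=
    b.hasCompactSupport.comp_left (g := fun r : ℝ => (r : ℂ)) Complex.ofReal_zero
  have hd : ContDiff ℝ (⊤ : ℕ∞) fun x => (b x : ℂ) := Complex.ofRealCLM.contDiff.comp b.contDiff
  have hn (x : EuclideanSpace ℝ (Fin N)) : ‖(b x : ℂ)‖ = b x := by
    rw [Complex.norm_real, Real.norm_of_nonneg b.nonneg]
  refine ⟨hc.toSchwartzMap hd, fun x => (hn x).trans_le b.le_one,
    fun x => congrArg Complex.ofReal (hn x), fun x hx => ?_⟩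
  have hbx : b x = 1 := b.one_of_mem_closedBall (by simpa using hx)
  exact congrArg Complex.ofReal hbx

lemma separatingRight_mul (k : Type*) [Field k] : (LinearMap.mul k k).SeparatingRight :=
  fun y h => by simpa using h 1

lemma exists_locallyConstant_bump (E : Type*) [NormedAddCommGroup E] [IsUltrametricDist E]
    [ProperSpace E] : ∃ f : E → ℂ, IsLocallyConstant f ∧ HasCompactSupport f ∧
      (∀ x, ‖f x‖ ≤ 1) ∧ (∀ x, ((‖f x‖ : ℝ) : ℂ) = f x) ∧ f 0 = 1 := by
  have hcl : IsClopen (Metric.closedBall (0 : E) 1) :=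
    IsUltrametricDist.isClopen_closedBall _ one_ne_zero
  refine ⟨(Metric.closedBall (0 : E) 1).indicator fun _ => (1 : ℂ),
    (LocallyConstant.charFn ℂ hcl).isLocallyConstant,
    .of_support_subset_isCompact (isCompact_closedBall _ _) Set.support_indicator_subset,
    fun x => ?_, fun x => ?_, by simp⟩ <;>
  by_cases hx : x ∈ Metric.closedBall (0 : E) 1 <;> simp [hx]

variable {k : Type*} [NontriviallyNormedField k] [LocallyCompactSpace k]
  [MeasurableSpace k] [BorelSpace k] {ψ : AddChar k Circle} {μ : Measure k} [μ.IsAddHaarMeasure]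

theorem exists_isSummationKernel_of_isUltrametricDist [IsUltrametricDist k] (hψ : Continuous ψ)
    (hψ1 : ψ ≠ 1) : ∃ K : k → ℂ, IsSummationKernel ψ μ K := by
  have : ProperSpace k := .of_locallyCompactSpace k
  obtain ⟨f, hfl, hfc, hf1, hf0, hf⟩ := exists_locallyConstant_bump k
  exact ⟨f, .of_isLocallyConstant hψ hψ1 (separatingRight_mul k) hfl hfc, hf1, hf0, hf⟩

theorem exists_isSummationKernel_of_euclidean {d : ℕ} (g : k ≃ₜ+ EuclideanSpace ℝ (Fin d))
    (hψ : Continuous ψ) (hψ1 : ψ ≠ 1) : ∃ K : k → ℂ, IsSummationKernel ψ μ K := by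
  obtain ⟨f, hf1, hf0, hf⟩ := exists_schwartz_bump d
  exact ⟨fun x => f (g x), .of_schwartz g hψ hψ1 (separatingRight_mul k) g f,
    fun x => hf1 _, fun x => hf0 _, hf _ (by simp)⟩

end Kernel

section Domination

lemma schwartz_dyadic_bound {E F : Type*} [NormedAddCommGroup E] [NormedSpace ℝ E]
    [NormedAddCommGroup F] [NormedSpace ℝ F] (s : SchwartzMap E F) (M : ℕ) :
    ∃ A : ℝ, 0 ≤ A ∧ ∀ x, ∃ j : ℕ, ‖x‖ ≤ 2 ^ j ∧ ‖s x‖ ≤ A * ((2 : ℝ) ^ j)⁻¹ ^ M := by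
  obtain ⟨D₀, hD₀, h₀⟩ := s.decay 0 0
  obtain ⟨D, hD, h⟩ := s.decay M 0
  simp only [pow_zero, one_mul, norm_iteratedFDeriv_zero] at h₀ h
  refine ⟨D₀ + 2 ^ M * D, by positivity, fun x => ?_⟩
  rcases le_or_gt ‖x‖ 1 with hx | hx
  · refine ⟨0, by simpa using hx, ?_⟩
    have : 0 ≤ 2 ^ M * D := by positivity
    simpa using (h₀ x).trans (by linarith)
  · obtain ⟨i, hi, hi'⟩ := exists_nat_pow_near hx.le (one_lt_two (α := ℝ))
    refine ⟨i + 1, hi'.le, ?_⟩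
    have hDx : (2 ^ i : ℝ) ^ M * ‖s x‖ ≤ D := le_trans (by gcongr) (h x)
    rw [inv_pow, ← div_eq_mul_inv, le_div_iff₀ (by positivity)]
    calc ‖s x‖ * ((2 : ℝ) ^ (i + 1)) ^ M = 2 ^ M * ((2 ^ i) ^ M * ‖s x‖) := by ring
      _ ≤ 2 ^ M * D := by gcongr
      _ ≤ D₀ + 2 ^ M * D := by linarith

lemma map_inv_two_pow_smul {k V E : Type*} [Field k] [NeZero (2 : k)] [AddCommGroup V] [Module k V]
    [AddCommGroup E] [Module ℝ E] (e : V →+ E) (j : ℕ) (X : V) :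
    e (((2 : k) ^ j)⁻¹ • X) = ((2 : ℝ) ^ j)⁻¹ • e X := by
  rw [eq_inv_smul_iff₀ (by positivity)]
  calc (2 : ℝ) ^ j • e (((2 : k) ^ j)⁻¹ • X) = e ((2 ^ j : ℕ) • ((2 : k) ^ j)⁻¹ • X) := by
        rw [map_nsmul, ← Nat.cast_smul_eq_nsmul ℝ, Nat.cast_pow, Nat.cast_ofNat]
    _ = e X := by
        rw [← Nat.cast_smul_eq_nsmul k, Nat.cast_pow, Nat.cast_ofNat,
          smul_inv_smul₀ (pow_ne_zero j two_ne_zero)]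

variable {k : Type*} [NontriviallyNormedField k] [LocallyCompactSpace k]
  [MeasurableSpace k] [BorelSpace k] {μ : Measure k} [μ.IsAddHaarMeasure]

lemma eLpNorm_two_comp_mul_left {a : k} (ha : a ≠ 0) (H : k → ℂ) :
    eLpNorm (fun x => H (a * x)) 2 μ =
      ENNReal.ofReal (modulus a)⁻¹ ^ (1 / 2 : ℝ) * eLpNorm H 2 μ := by
  rw [eLpNorm_two_eq, eLpNorm_two_eq, lintegral_comp_mul_left μ ha (fun x => ‖H x‖ₑ ^ 2),
    ENNReal.mul_rpow_of_nonneg _ _ (by norm_num)]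

lemma eLpNorm_two_comp_mul_self_mul {a : k} (ha : a ≠ 0) (H : k → ℂ) :
    eLpNorm (fun x => H (a * a * x)) 2 μ = ENNReal.ofReal (modulus a)⁻¹ * eLpNorm H 2 μ := by
  have hinv := inv_nonneg.2 (modulus_nonneg a)
  rw [eLpNorm_two_comp_mul_left (mul_ne_zero ha ha),
    ENNReal.ofReal_rpow_of_nonneg (inv_nonneg.2 (modulus_nonneg _)) (by norm_num),
    modulus_mul, mul_inv, ← sq, ← Real.sqrt_eq_rpow, Real.sqrt_sq hinv]

variable {V : Type*} [AddCommGroup V] [Module k V] [FiniteDimensional k V]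
  [TopologicalSpace V] [IsTopologicalAddGroup V] [ContinuousSMul k V] [T2Space V]
  [MeasurableSpace V] [BorelSpace V] {ν : Measure V} [ν.IsAddHaarMeasure]
  {q : QuadraticForm k V}

lemma lintegral_dilate_le {Φ : V → ℂ} {C : ℝ≥0∞}
    (hΦ : ∀ H : k → ℂ, Measurable H → MemLp H 2 μ →
      ∫⁻ X, ‖Φ X‖ₑ * ‖H (q X)‖ₑ ∂ν ≤ C * eLpNorm H 2 μ)
    {a : k} (ha : a ≠ 0) {H : k → ℂ} (hHm : Measurable H) (hH : MemLp H 2 μ) :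
    ∫⁻ X, ‖Φ (a⁻¹ • X)‖ₑ * ‖H (q X)‖ₑ ∂ν ≤
      ENNReal.ofReal (modulus a ^ Module.finrank k V * (modulus a)⁻¹) * C * eLpNorm H 2 μ := by
  have hp := modulus_pos ha
  have hHa : Measurable fun x => H (a * a * x) := hHm.comp (measurable_const_mul _)
  have hHa2 : MemLp (fun x => H (a * a * x)) 2 μ := by
    refine ⟨hHa.aestronglyMeasurable, ?_⟩
    rw [eLpNorm_two_comp_mul_self_mul ha]
    exact ENNReal.mul_lt_top ENNReal.ofReal_lt_top hH.2
  have hscale := lintegral_comp_smul ν ha fun X => ‖Φ (a⁻¹ • X)‖ₑ * ‖H (q X)‖ₑ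
  simp only [inv_smul_smul₀ ha, QuadraticMap.map_smul, smul_eq_mul] at hscale
  calc ∫⁻ X, ‖Φ (a⁻¹ • X)‖ₑ * ‖H (q X)‖ₑ ∂ν
      = ENNReal.ofReal (modulus a ^ Module.finrank k V) *
          ∫⁻ X, ‖Φ X‖ₑ * ‖H (a * a * q X)‖ₑ ∂ν := by
        rw [hscale, ← mul_assoc, ← ENNReal.ofReal_mul (by positivity),
          mul_inv_cancel₀ (by positivity), ENNReal.ofReal_one, one_mul]
    _ ≤ ENNReal.ofReal (modulus a ^ Module.finrank k V) *
          (C * eLpNorm (fun x => H (a * a * x)) 2 μ) := mul_le_mul_right (hΦ _ hHa hHa2) _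
    _ = _ := by
        rw [eLpNorm_two_comp_mul_self_mul ha, ENNReal.ofReal_mul (by positivity)]
        ring

theorem isQuadraticallyBounded_of_le_tsum [NeZero (2 : k)] {ι : Type*} [Countable ι] {φ Φ : V → ℂ}
    {a : ι → k} (ha : ∀ i, a i ≠ 0) {w : ι → ℝ≥0∞} (hΦc : Continuous Φ)
    (hΦ : IsQuadraticallyBounded μ ν q Φ)
    (hφ : ∀ X, ‖φ X‖ₑ ≤ ∑' i, w i * ‖Φ ((a i)⁻¹ • X)‖ₑ)
    (hw : ∑' i, w i * ENNReal.ofReal (modulus (a i) ^ Module.finrank k V * (modulus (a i))⁻¹) ≠ ∞) :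
    IsQuadraticallyBounded μ ν q φ := by
  obtain ⟨C, hC, hΦC⟩ := hΦ
  refine ⟨_, ENNReal.mul_ne_top hw hC, fun H hHm hH => ?_⟩
  have hm (i : ι) : Measurable fun X => ‖Φ ((a i)⁻¹ • X)‖ₑ * ‖H (q X)‖ₑ :=
    (hΦc.comp (continuous_const_smul _)).enorm.measurable.mul
      (hHm.comp (continuous_quadraticForm q).measurable).enorm
  calc ∫⁻ X, ‖φ X‖ₑ * ‖H (q X)‖ₑ ∂ν
      ≤ ∫⁻ X, ∑' i, w i * (‖Φ ((a i)⁻¹ • X)‖ₑ * ‖H (q X)‖ₑ) ∂ν := by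
        refine lintegral_mono fun X => (mul_le_mul_left (hφ X) _).trans_eq ?_
        simp only [← ENNReal.tsum_mul_right, mul_assoc]
    _ = ∑' i, w i * ∫⁻ X, ‖Φ ((a i)⁻¹ • X)‖ₑ * ‖H (q X)‖ₑ ∂ν := by
        rw [lintegral_tsum fun i => ((hm i).const_mul _).aemeasurable]
        exact tsum_congr fun i => lintegral_const_mul _ (hm i)
    _ ≤ ∑' i, w i * (ENNReal.ofReal (modulus (a i) ^ Module.finrank k V * (modulus (a i))⁻¹) *
          C * eLpNorm H 2 μ) :=
        ENNReal.tsum_le_tsum fun i => mul_le_mul_right (lintegral_dilate_le hΦC (ha i) hHm hH) _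
    _ = _ := by simp only [← ENNReal.tsum_mul_right, mul_assoc]

theorem isQuadraticallyBounded_of_schwartz [NeZero (2 : k)] {N : ℕ}
    (e : V ≃ₜ+ EuclideanSpace ℝ (Fin N)) {Φ : V → ℂ} (hΦc : Continuous Φ)
    (hΦ1 : ∀ X, ‖e X‖ ≤ 1 → Φ X = 1) (hΦ : IsQuadraticallyBounded μ ν q Φ)
    (s : SchwartzMap (EuclideanSpace ℝ (Fin N)) ℂ) :
    IsQuadraticallyBounded μ ν q fun X => s (e X) := by
  set ρ : ℝ := modulus (2 : k) ^ Module.finrank k V * (modulus (2 : k))⁻¹ with hρ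
  have hρ0 : 0 ≤ ρ := mul_nonneg (pow_nonneg (modulus_nonneg _) _) (inv_nonneg.2 (modulus_nonneg _))
  have hρj (j : ℕ) : modulus ((2 : k) ^ j) ^ Module.finrank k V * (modulus ((2 : k) ^ j))⁻¹ =
      ρ ^ j := by
    rw [hρ, modulus_pow, mul_pow, inv_pow, pow_right_comm]
  obtain ⟨M, hM⟩ : ∃ M : ℕ, ρ < 2 ^ M := pow_unbounded_of_one_lt _ one_lt_two
  obtain ⟨A, hA, hs⟩ := schwartz_dyadic_bound s M
  refine isQuadraticallyBounded_of_le_tsum (a := fun j : ℕ => (2 : k) ^ j)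
    (w := fun j => ENNReal.ofReal (A * ((2 : ℝ) ^ j)⁻¹ ^ M)) (fun j => pow_ne_zero j two_ne_zero)
    hΦc hΦ (fun X => ?_) ?_
  · obtain ⟨j, hj, hsj⟩ := hs (e X)
    have hΦj : Φ (((2 : k) ^ j)⁻¹ • X) = 1 := by
      refine hΦ1 _ ?_
      have hdil : e (((2 : k) ^ j)⁻¹ • X) = _ := map_inv_two_pow_smul e.toAddMonoidHom j X
      rw [hdil, norm_smul, norm_inv, norm_pow, Real.norm_ofNat, inv_mul_le_one₀ (by positivity)]
      exact hj
    refine le_trans ?_ (ENNReal.le_tsum j)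
    rw [hΦj, enorm_one, mul_one, ← ofReal_norm]
    exact ENNReal.ofReal_le_ofReal hsj
  · have hsum : Summable fun j : ℕ => A * (ρ / 2 ^ M) ^ j :=
      (summable_geometric_of_lt_one (by positivity) ((div_lt_one (by positivity)).2 hM)).mul_left A
    have hterm (j : ℕ) : A * ((2 : ℝ) ^ j)⁻¹ ^ M * ρ ^ j = A * (ρ / 2 ^ M) ^ j := by
      rw [inv_pow, pow_right_comm, div_pow]
      ring
    simp only [← ENNReal.ofReal_mul (mul_nonneg hA (by positivity : 0 ≤ ((2 : ℝ) ^ _)⁻¹ ^ M)), hρj,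
      hterm]
    exact hsum.tsum_ofReal_ne_top

end Domination

section BruhatSchwartz

variable {k : Type*} [NontriviallyNormedField k] [LocallyCompactSpace k]
  [MeasurableSpace k] [BorelSpace k]
  {V : Type*} [AddCommGroup V] [Module k V]
  [TopologicalSpace V] [IsTopologicalAddGroup V] [ContinuousSMul k V] [T2Space V]
  {ψ : AddChar k Circle} {φ : V → ℂ}

theorem IsBruhatSchwartz.exists_isSummationKernel [Nontrivial V] (hφ : IsBruhatSchwartz k φ)
    {μ : Measure k} [μ.IsAddHaarMeasure] (hψ : Continuous ψ) (hψ1 : ψ ≠ 1) :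
    ∃ K : k → ℂ, IsSummationKernel ψ μ K := by
  rcases hφ with ⟨hk, -, -⟩ | ⟨-, N, e, -, -⟩
  · exact exists_isSummationKernel_of_isUltrametricDist hψ hψ1
  · obtain ⟨d, ⟨g⟩⟩ := exists_continuousAddEquiv_euclidean (k := k) e
    exact exists_isSummationKernel_of_euclidean g hψ hψ1

variable [FiniteDimensional k V] [MeasurableSpace V] [BorelSpace V] {ν : Measure V}

theorem IsBruhatSchwartz.hasIntegrableFourier [Nontrivial V] [ν.IsAddHaarMeasure]
    (hφ : IsBruhatSchwartz k φ) (hψ : Continuous ψ) (hψ1 : ψ ≠ 1)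
    {B : LinearMap.BilinForm k V} (hB : B.SeparatingRight) : HasIntegrableFourier ψ B ν φ := by
  rcases hφ with ⟨_, hl, hc⟩ | ⟨-, N, e, s, hs⟩
  · exact .of_isLocallyConstant hψ hψ1 hB hl hc
  · obtain rfl : φ = fun X => s (e X) := funext hs
    obtain ⟨d, ⟨g⟩⟩ := exists_continuousAddEquiv_euclidean (k := k) e
    exact .of_schwartz e hψ hψ1 hB g s

variable [NeZero (2 : k)] {μ : Measure k} {q : QuadraticForm k V}

lemma separatingRight_polarBilin {k V : Type*} [Field k] [NeZero (2 : k)] [AddCommGroup V]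
    [Module k V] {q : QuadraticForm k V} (hq : q.Nondegenerate) :
    (QuadraticMap.polarBilin q).SeparatingRight :=
  have : Invertible (2 : k) := invertibleOfNonzero two_ne_zero
  (QuadraticMap.nondegenerate_polar_iff.2 hq).2

theorem isQuadraticallyBounded_of_isLocallyConstant [IsUltrametricDist k]
    (hφ : IsLocallyConstant φ) (hφc : HasCompactSupport φ) (hψ : Continuous ψ) (hψ1 : ψ ≠ 1)
    (hq : q.Nondegenerate) (hV : 2 ≤ Module.finrank k V) (hμ : IsSelfDual ψ (LinearMap.mul k k) μ)
    (hν : IsSelfDual ψ (QuadraticMap.polarBilin q) ν) : IsQuadraticallyBounded μ ν q φ := by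
  have := hμ.1
  have := hν.1
  obtain ⟨K, hK⟩ := exists_isSummationKernel_of_isUltrametricDist (μ := μ) hψ hψ1
  have hnorm : IsLocallyConstant fun X => ((‖φ X‖ : ℝ) : ℂ) := hφ.comp fun z => ((‖z‖ : ℝ) : ℂ)
  have hnormc : HasCompactSupport fun X => ((‖φ X‖ : ℝ) : ℂ) :=
    hφc.comp_left (g := fun z : ℂ => ((‖z‖ : ℝ) : ℂ)) (by simp)
  obtain ⟨C, hC, h⟩ := isQuadraticallyBounded_of_nonneg hψ hμ hK hV hν
    (.of_isLocallyConstant hψ hψ1 (separatingRight_polarBilin hq) hnorm hnormc) (fun X => by simp)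
  simp only [← ofReal_norm (((‖φ _‖ : ℝ) : ℂ)), Complex.norm_real, norm_norm, ofReal_norm] at h
  exact ⟨C, hC, h⟩

theorem IsBruhatSchwartz.isQuadraticallyBounded (hφ : IsBruhatSchwartz k φ)
    (hψ : Continuous ψ) (hψ1 : ψ ≠ 1) (hq : q.Nondegenerate) (hV : 2 ≤ Module.finrank k V)
    (hμ : IsSelfDual ψ (LinearMap.mul k k) μ)
    (hν : IsSelfDual ψ (QuadraticMap.polarBilin q) ν) : IsQuadraticallyBounded μ ν q φ := by
  rcases hφ with ⟨hk, hl, hc⟩ | ⟨-, N, e, s, hs⟩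
  · exact isQuadraticallyBounded_of_isLocallyConstant hl hc hψ hψ1 hq hV hμ hν
  have := hμ.1
  have := hν.1
  have : Nontrivial V := Module.nontrivial_of_finrank_pos (R := k) (two_pos.trans_le hV)
  obtain rfl : φ = fun X => s (e X) := funext hs
  obtain ⟨d, ⟨g⟩⟩ := exists_continuousAddEquiv_euclidean (k := k) e
  obtain ⟨K, hK⟩ := exists_isSummationKernel_of_euclidean (μ := μ) g hψ hψ1
  obtain ⟨f, -, hf0, hf⟩ := exists_schwartz_bump N
  refine isQuadraticallyBounded_of_schwartz e (f.continuous.comp e.continuous)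
    (fun X hX => hf _ hX) ?_ s
  exact isQuadraticallyBounded_of_nonneg hψ hμ hK hV hν
    (.of_schwartz e hψ hψ1 (separatingRight_polarBilin hq) g f) fun X => hf0 _

end BruhatSchwartz

section Squaring

lemma root_sq {k : Type*} [Field k] (r : k) : root (r ^ 2) = r ∨ root (r ^ 2) = -r := by
  have h : ∃ x : k, x ^ 2 = r ^ 2 := ⟨r, rfl⟩
  rw [root, dif_pos h]
  exact sq_eq_sq_iff_eq_or_eq_neg.1 h.choose_spec

lemma comp_root_sq {k A : Type*} [Field k] {W : k → A} (hW : ∀ x, W (-x) = W x) (r : k) :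
    W (root (r ^ 2)) = W r := by
  rcases root_sq r with h | h <;> simp [h, hW]

variable {k : Type*} [NontriviallyNormedField k] [LocallyCompactSpace k]

lemma squareDensity_nonneg (u : k) : 0 ≤ squareDensity u :=
  mul_nonneg (mul_nonneg zero_le_two (inv_nonneg.2 (modulus_nonneg _)))
    (Real.rpow_nonneg (modulus_nonneg _) _)

lemma squareDensity_sq (r : k) :
    squareDensity (r ^ 2) = 2 * (modulus (2 : k))⁻¹ * (modulus r)⁻¹ := by
  rw [squareDensity, modulus_pow, ← Real.rpow_natCast, ← Real.rpow_mul (modulus_nonneg r),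
    ← Real.rpow_neg_one (modulus r)]
  norm_num

variable [MeasurableSpace k] [BorelSpace k]

lemma exists_measurable_sqrt (k : Type*) [NontriviallyNormedField k] [LocallyCompactSpace k]
    [MeasurableSpace k] [BorelSpace k] :
    ∃ s : k → k, Measurable s ∧ ∀ r, s (r ^ 2) = r ∨ s (r ^ 2) = -r := by
  -- Ordering `k` through a Borel embedding into `ℝ` chooses one root from each pair `±r`.
  have he := measurableEmbedding_embeddingReal k
  let P : Set k := {x | embeddingReal k (-x) ≤ embeddingReal k x}
  have hP : MeasurableSet P := measurableSet_le (he.measurable.comp measurable_neg) he.measurable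
  have hinj : Set.InjOn (fun x : k => x ^ 2) P := by
    intro x hx y hy hxy
    rcases sq_eq_sq_iff_eq_or_eq_neg.1 hxy with h | h
    · exact h
    · exact he.injective (le_antisymm (by simpa [P, h] using hy) (by simpa [P, h] using hx))
  have hemb : MeasurableEmbedding (P.domRestrict fun x : k => x ^ 2) :=
    (continuous_pow 2).continuousOn.measurableEmbedding hP hinj
  obtain ⟨s, hs, hsP⟩ := hemb.exists_measurable_extend (g := fun x : P => (x : k))
    measurable_subtype_coe fun _ => ⟨0⟩
  have hsr (r : k) (hr : r ∈ P) : s (r ^ 2) = r := congrFun hsP ⟨r, hr⟩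
  refine ⟨s, hs, fun r => ?_⟩
  rcases le_total (embeddingReal k (-r)) (embeddingReal k r) with h | h
  · exact Or.inl (hsr r h)
  · rw [← neg_sq]
    exact Or.inr (hsr (-r) (by simpa [P] using h))

variable {μ : Measure k} [μ.IsAddHaarMeasure]

lemma quasiMeasurePreserving_sqrt {s : k → k} (hs : Measurable s)
    (hsr : ∀ r, s (r ^ 2) = r ∨ s (r ^ 2) = -r) :
    Measure.QuasiMeasurePreserving s (μ.map fun x => x ^ 2) μ := by
  refine ⟨hs, Measure.AbsolutelyContinuous.mk fun N hN hN0 => ?_⟩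
  rw [Measure.map_apply hs hN, Measure.map_apply (continuous_pow 2).measurable (hs hN)]
  refine measure_mono_null (t := N ∪ -N) (fun r hr => ?_)
    (measure_union_null hN0 ((Measure.measure_neg μ N).trans hN0))
  exact (hsr r).imp (fun h => by simpa [h] using hr) fun h => by simpa [h] using hr

variable [NeZero (2 : k)]

lemma ae_map_sq_mem_nonzeroSquares : ∀ᵐ u ∂μ.map (fun x => x ^ 2), u ∈ nonzeroSquares k := by
  rw [map_sq_haar]
  exact (withDensity_absolutelyContinuous _ _).ae_le
    (ae_restrict_mem isOpen_nonzeroSquares.measurableSet)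

lemma aestronglyMeasurable_comp_root {A : Type*} [TopologicalSpace A] {W : k → A}
    (hW : AEStronglyMeasurable W μ) (hWe : ∀ x, W (-x) = W x) :
    AEStronglyMeasurable (fun u => W (root u)) (μ.map fun x => x ^ 2) := by
  obtain ⟨s, hs, hsr⟩ := exists_measurable_sqrt k
  refine (hW.comp_quasiMeasurePreserving (quasiMeasurePreserving_sqrt hs hsr)).congr ?_
  filter_upwards [ae_map_sq_mem_nonzeroSquares] with u hu
  obtain ⟨r, -, rfl⟩ := hu
  rw [Function.comp_apply, comp_root_sq hWe]
  rcases hsr r with h | h <;> simp [h, hWe]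

lemma integral_comp_sq {g : k → ℂ} (hg : AEStronglyMeasurable g (μ.map fun x => x ^ 2)) :
    ∫ r, g (r ^ 2) ∂μ =
      ∫ u, (nonzeroSquares k).indicator (fun u => (squareDensity u : ℂ) * g u) u ∂μ := by
  rw [integral_indicator isOpen_nonzeroSquares.measurableSet,
    ← integral_map (continuous_pow 2).measurable.aemeasurable hg, map_sq_haar,
    integral_withDensity_eq_integral_toReal_smul measurable_squareDensity.ennreal_ofReal
      (ae_of_all _ fun _ => ENNReal.ofReal_lt_top)]
  simp only [ENNReal.toReal_ofReal (squareDensity_nonneg _), Complex.real_smul]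

lemma integrable_comp_sq {g : k → ℂ} (hg : AEStronglyMeasurable g (μ.map fun x => x ^ 2))
    (hi : Integrable (fun r => g (r ^ 2)) μ) :
    Integrable ((nonzeroSquares k).indicator fun u => (squareDensity u : ℂ) * g u) μ := by
  have h := (integrable_map_measure hg (continuous_pow 2).measurable.aemeasurable).2 hi
  rw [map_sq_haar, integrable_withDensity_iff_integrable_smul'
    measurable_squareDensity.ennreal_ofReal (ae_of_all _ fun _ => ENNReal.ofReal_lt_top)] at h
  simp only [ENNReal.toReal_ofReal (squareDensity_nonneg _), Complex.real_smul] at h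
  exact (integrable_indicator_iff isOpen_nonzeroSquares.measurableSet).2 h

/-- The density with respect to Haar measure of the image of the measure `W(r) dr` under
`r ↦ r ^ 2`, for even `W`. -/
noncomputable def pushSquare (W : k → ℂ) : k → ℂ :=
  (nonzeroSquares k).indicator fun u => (squareDensity u : ℂ) * W (root u)

variable {W : k → ℂ}

lemma integrable_pushSquare (hW : Integrable W μ) (hWe : ∀ x, W (-x) = W x) :
    Integrable (pushSquare W) μ :=
  integrable_comp_sq (aestronglyMeasurable_comp_root hW.1 hWe) (by simpa only [comp_root_sq hWe])

lemma memLp_two_pushSquare (hW : Integrable W μ) (hWe : ∀ x, W (-x) = W x)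
    (hW2 : Integrable (fun x => W x ^ 2 * (((modulus x)⁻¹ : ℝ) : ℂ)) μ) :
    MemLp (pushSquare W) 2 μ := by
  have hm := aestronglyMeasurable_comp_root hW.1 hWe
  have hd : AEStronglyMeasurable (fun u : k => (squareDensity u : ℂ)) (μ.map fun x => x ^ 2) :=
    (Complex.measurable_ofReal.comp measurable_squareDensity).aestronglyMeasurable
  have integrable_sq : Integrable ((nonzeroSquares k).indicator fun u =>
      (squareDensity u : ℂ) * (squareDensity u * W (root u) ^ 2)) μ := by
    refine integrable_comp_sq (hd.mul (hm.pow 2)) ?_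
    refine (hW2.const_mul ((2 * (modulus (2 : k))⁻¹ : ℝ) : ℂ)).congr (ae_of_all _ fun r => ?_)
    simp only [comp_root_sq hWe, squareDensity_sq]
    push_cast
    ring
  refine (memLp_two_iff_integrable_sq_norm (integrable_pushSquare hW hWe).1).2
    (integrable_sq.norm.congr (ae_of_all _ fun u => ?_))
  by_cases hu : u ∈ nonzeroSquares k
  · simp only [pushSquare, Set.indicator_of_mem hu, ← norm_pow]
    ring_nf
  · simp [pushSquare, hu]

lemma fourierField_pushSquare {ψ : AddChar k Circle} (hψ : Continuous ψ)
    (hW : AEStronglyMeasurable W μ) (hWe : ∀ x, W (-x) = W x) (t : k) :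
    fourierField ψ μ (pushSquare W) t = fourierTwo ψ μ W t := by
  have hc : AEStronglyMeasurable (fun u : k => (ψ (u * t) : ℂ)) (μ.map fun x => x ^ 2) :=
    ((continuous_char hψ).comp (continuous_mul_const t)).measurable.aestronglyMeasurable
  have h := integral_comp_sq ((aestronglyMeasurable_comp_root hW hWe).mul hc)
  simp only [Pi.mul_apply, comp_root_sq hWe] at h
  rw [fourierField_apply, fourierTwo, h]
  refine integral_congr_ae (ae_of_all _ fun u => ?_)
  by_cases hu : u ∈ nonzeroSquares k <;> simp [pushSquare, hu, mul_assoc]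

end Squaring

section SquareClass

variable {k : Type*} [NontriviallyNormedField k] [LocallyCompactSpace k] {δ : k}

/-- The density with respect to Haar measure of the image of the measure `W(r) dr` under
`r ↦ δ * r ^ 2`, for even `W` and `δ ≠ 0`. -/
noncomputable def pushSquareClass (δ : k) (W : k → ℂ) (u : k) : ℂ :=
  (((modulus δ)⁻¹ : ℝ) : ℂ) * pushSquare W (δ⁻¹ * u)

lemma mem_squareClassSet_iff {k V : Type*} [Field k] [AddCommGroup V] [Module k V]
    {q : QuadraticForm k V} {δ : k} (hδ : δ ≠ 0) {X : V} :
    X ∈ squareClassSet q δ ↔ δ⁻¹ * q X ∈ nonzeroSquares k := by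
  simp only [squareClassSet, nonzeroSquares, Set.mem_ofPred_eq]
  refine exists_congr fun a => and_congr_right fun _ => ?_
  rw [eq_inv_mul_iff_mul_eq₀ hδ, eq_comm]

lemma mul_pushSquareClass_comp {V : Type*} [AddCommGroup V] [Module k V] (q : QuadraticForm k V)
    (hδ : δ ≠ 0) (W : k → ℂ) (φ : V → ℂ) (X : V) :
    φ X * pushSquareClass δ W (q X) = 2 * (((modulus (2 * δ))⁻¹ : ℝ) : ℂ) *
      (squareClassSet q δ).indicator (fun X => W (root (δ⁻¹ * q X)) * φ X *
        ((modulus (δ⁻¹ * q X) ^ (-(1 / 2) : ℝ) : ℝ) : ℂ)) X := by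
  by_cases hX : X ∈ squareClassSet q δ
  · have hX' := (mem_squareClassSet_iff hδ).1 hX
    rw [Set.indicator_of_mem hX]
    simp only [pushSquareClass, pushSquare, Set.indicator_of_mem hX', squareDensity,
      modulus_mul 2 δ, mul_inv]
    push_cast
    ring
  · have hX' := mt (mem_squareClassSet_iff hδ).2 hX
    simp [hX, pushSquareClass, pushSquare, hX']

lemma isOpen_squareClassSet [NeZero (2 : k)] {V : Type*} [AddCommGroup V] [Module k V]
    [FiniteDimensional k V] [TopologicalSpace V] [IsTopologicalAddGroup V] [ContinuousSMul k V]
    [T2Space V] (q : QuadraticForm k V) (hδ : δ ≠ 0) : IsOpen (squareClassSet q δ) := by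
  have h : squareClassSet q δ = (fun X => δ⁻¹ * q X) ⁻¹' nonzeroSquares k :=
    Set.ext fun X => mem_squareClassSet_iff hδ
  rw [h]
  exact isOpen_nonzeroSquares.preimage (continuous_const.mul (continuous_quadraticForm q))

variable [MeasurableSpace k] [BorelSpace k] {μ : Measure k} [μ.IsAddHaarMeasure]

lemma fourierField_comp_mul_left (ψ : AddChar k Circle) (hδ : δ ≠ 0) (G : k → ℂ) (t : k) :
    fourierField ψ μ (fun u => (((modulus δ)⁻¹ : ℝ) : ℂ) * G (δ⁻¹ * u)) t =
      fourierField ψ μ G (δ * t) := by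
  have h := integral_comp_mul_left μ (inv_ne_zero hδ) fun u => G u * (ψ (u * (δ * t)) : ℂ)
  have hp : ((modulus δ : ℝ) : ℂ) ≠ 0 := Complex.ofReal_ne_zero.2 (modulus_pos hδ).ne'
  have hu (u : k) : δ⁻¹ * (u * (δ * t)) = u * t := by field_simp
  simp only [modulus_inv, inv_inv, mul_assoc, hu] at h
  simp only [fourierField_apply, mul_assoc, integral_const_mul]
  rw [h, Complex.ofReal_inv, inv_mul_cancel_left₀ hp]

lemma memLp_two_comp_mul_left (hδ : δ ≠ 0) {G : k → ℂ} (hG : MemLp G 2 μ) :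
    MemLp (fun u => G (δ * u)) 2 μ := by
  refine ⟨hG.1.comp_quasiMeasurePreserving ⟨measurable_const_mul δ, ?_⟩, ?_⟩
  · rw [map_mul_left_haar μ hδ]
    exact Measure.smul_absolutelyContinuous
  · rw [eLpNorm_two_comp_mul_left hδ]
    exact ENNReal.mul_lt_top (ENNReal.rpow_lt_top_of_nonneg (by norm_num) ENNReal.ofReal_ne_top)
      hG.2

variable [NeZero (2 : k)] {W : k → ℂ}

lemma integrable_pushSquareClass (hδ : δ ≠ 0) (hW : Integrable W μ) (hWe : ∀ x, W (-x) = W x) :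
    Integrable (pushSquareClass δ W) μ :=
  (integrable_comp_mul_left μ (inv_ne_zero hδ) (integrable_pushSquare hW hWe)).const_mul _

lemma memLp_two_pushSquareClass (hδ : δ ≠ 0) (hW : Integrable W μ) (hWe : ∀ x, W (-x) = W x)
    (hW2 : Integrable (fun x => W x ^ 2 * (((modulus x)⁻¹ : ℝ) : ℂ)) μ) :
    MemLp (pushSquareClass δ W) 2 μ :=
  (memLp_two_comp_mul_left (inv_ne_zero hδ) (memLp_two_pushSquare hW hWe hW2)).const_mul _

lemma fourierField_pushSquareClass {ψ : AddChar k Circle} (hψ : Continuous ψ) (hδ : δ ≠ 0)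
    (hW : AEStronglyMeasurable W μ) (hWe : ∀ x, W (-x) = W x) (t : k) :
    fourierField ψ μ (pushSquareClass δ W) t = fourierTwo ψ μ W (δ * t) :=
  (fourierField_comp_mul_left ψ hδ _ t).trans (fourierField_pushSquare hψ hW hWe _)

end SquareClass

end QuadraticFourier

open QuadraticFourier

theorem mainTheorem11_general
    {k : Type*} [NontriviallyNormedField k] [LocallyCompactSpace k] [NeZero (2 : k)]
    [MeasurableSpace k] [BorelSpace k]
    {V : Type*} [AddCommGroup V] [Module k V] [FiniteDimensional k V]
    [TopologicalSpace V] [IsTopologicalAddGroup V] [ContinuousSMul k V] [T2Space V]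
    [MeasurableSpace V] [BorelSpace V]
    (q : QuadraticForm k V) (hq : q.Nondegenerate) (hV : 2 ≤ Module.finrank k V)
    (ψ : AddChar k Circle) (hψc : Continuous ψ) (hψ : ψ ≠ 1)
    (μ : Measure k)
    (hμ : IsSelfDual ψ (LinearMap.mul k k) μ)
    (ν : Measure V)
    (hν : IsSelfDual ψ (QuadraticMap.polarBilin q) ν)
    (W : k → ℂ) (hW : Integrable W μ) (hWeven : ∀ x, W (-x) = W x)
    (hW2 : Integrable
      (fun x => W x ^ 2 * (((modulus x)⁻¹ : ℝ) : ℂ)) μ)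
    (φ : V → ℂ) (hφ : IsBruhatSchwartz k φ)
    (δ : k) (hδ : δ ≠ 0) :
    Integrable (fun t : k =>
      fourierTwo ψ μ W (δ * t) * fourierQuad ψ q ν φ (-t)) μ ∧
    IntegrableOn (fun X : V =>
      W (root (δ⁻¹ * q X)) * φ X *
        ((modulus (δ⁻¹ * q X) ^ (-(1 / 2) : ℝ) : ℝ) : ℂ))
      (squareClassSet q δ) ν ∧
    ∫ t : k, fourierTwo ψ μ W (δ * t) * fourierQuad ψ q ν φ (-t) ∂μ =
      2 * (((modulus (2 * δ))⁻¹ : ℝ) : ℂ) *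
        ∫ X in squareClassSet q δ,
          W (root (δ⁻¹ * q X)) * φ X *
            ((modulus (δ⁻¹ * q X) ^ (-(1 / 2) : ℝ) : ℝ) : ℂ) ∂ν := by
  have := hμ.1
  have := hν.1
  have : Nontrivial V := Module.nontrivial_of_finrank_pos (R := k) (two_pos.trans_le hV)
  obtain ⟨K, hK⟩ := hφ.exists_isSummationKernel (μ := μ) hψc hψ
  have hφF := hφ.hasIntegrableFourier (ν := ν) hψc hψ (separatingRight_polarBilin hq)
  have hb := hφ.isQuadraticallyBounded hψc hψ hq hV hμ hν
  have hG := integrable_pushSquareClass hδ hW hWeven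
  have hG2 := memLp_two_pushSquareClass hδ hW hWeven hW2
  have hS := (isOpen_squareClassSet q hδ).measurableSet
  have hc : IsUnit (2 * (((modulus (2 * δ))⁻¹ : ℝ) : ℂ)) := (mul_ne_zero two_ne_zero <|
    Complex.ofReal_ne_zero.2 (inv_ne_zero (modulus_pos (mul_ne_zero two_ne_zero hδ)).ne')).isUnit
  have integrable_left := integrable_fourierField_mul_fourierQuad hψc hK hV hν hφF hG hG2
  have integrable_right := hb.integrable_mul_comp hφF.continuous (continuous_quadraticForm q) hG2
  have parseval := integral_fourierField_mul_fourierQuad hψc hμ hK hV hν hφF hb hG hG2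
  simp only [fourierField_pushSquareClass hψc hδ hW.1 hWeven, mul_pushSquareClass_comp q hδ]
    at integrable_left integrable_right parseval
  rw [integral_const_mul, integral_indicator hS] at parseval
  rw [integrable_const_mul_iff hc, integrable_indicator_iff hS] at integrable_right
  exact ⟨integrable_left, integrable_right, parseval⟩

theorem mainTheorem11
    {k : Type*} [NontriviallyNormedField k] [LocallyCompactSpace k] [CharZero k]
    [MeasurableSpace k] [BorelSpace k]
    {V : Type*} [AddCommGroup V] [Module k V] [FiniteDimensional k V]
    [TopologicalSpace V] [IsTopologicalAddGroup V] [ContinuousSMul k V] [T2Space V]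
    [MeasurableSpace V] [BorelSpace V]
    (q : QuadraticForm k V) (hq : q.Nondegenerate) (hV : 2 ≤ Module.finrank k V)
    (ψ : AddChar k Circle) (hψc : Continuous ψ) (hψ : ψ ≠ 1)
    (μ : MeasureTheory.Measure k)
    (hμ : QuadraticFourier.IsSelfDual ψ (LinearMap.mul k k) μ)
    (ν : MeasureTheory.Measure V)
    (hν : QuadraticFourier.IsSelfDual ψ (QuadraticMap.polarBilin q) ν)
    (W : k → ℂ) (hW : MeasureTheory.Integrable W μ) (hWeven : ∀ x, W (-x) = W x)
    (hW2 : MeasureTheory.Integrable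
      (fun x => W x ^ 2 * (((QuadraticFourier.modulus x)⁻¹ : ℝ) : ℂ)) μ)
    (φ : V → ℂ) (hφ : QuadraticFourier.IsBruhatSchwartz k φ)
    (δ : k) (hδ : δ ≠ 0) :
    MeasureTheory.Integrable (fun t : k =>
      QuadraticFourier.fourierTwo ψ μ W (δ * t) * QuadraticFourier.fourierQuad ψ q ν φ (-t)) μ ∧
    MeasureTheory.IntegrableOn (fun X : V =>
      W (QuadraticFourier.root (δ⁻¹ * q X)) * φ X *
        ((QuadraticFourier.modulus (δ⁻¹ * q X) ^ (-(1 / 2) : ℝ) : ℝ) : ℂ))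
      (QuadraticFourier.squareClassSet q δ) ν ∧
    ∫ t : k, QuadraticFourier.fourierTwo ψ μ W (δ * t) *
        QuadraticFourier.fourierQuad ψ q ν φ (-t) ∂μ =
      2 * (((QuadraticFourier.modulus (2 * δ))⁻¹ : ℝ) : ℂ) *
        ∫ X in QuadraticFourier.squareClassSet q δ,
          W (QuadraticFourier.root (δ⁻¹ * q X)) * φ X *
            ((QuadraticFourier.modulus (δ⁻¹ * q X) ^ (-(1 / 2) : ℝ) : ℝ) : ℂ) ∂ν :=
  mainTheorem11_general q hq hV ψ hψc hψ μ hμ ν hν W hW hWeven hW2 φ hφ δ hδ
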